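/- Let $n\ge 1$ and let $\Gamma<\mathrm{Isom}(\mathbb H^n)$ be a discrete subgroup. Let $\mathrm{hull}(\Gamma)\subset\mathbb H^n$ be the convex hull of the limit set $\Lambda(\Gamma)\subset\partial_\infty\mathbb H^n$, i.e. the smallest convex subset of $\mathbb H^n$ containing every geodesic line with both endpoints in $\Lambda(\Gamma)$ (it is empty if $\Lambda(\Gamma)$ has at most one point). For $\epsilon>0$ let $$\mathrm{Thin}_\epsilon(\Gamma)=\{x\in\mathbb H^n \mid \exists\,\gamma\in\Gamma,\ \gamma\neq 1,\ d(x,\gamma(x))<\epsilon\},$$ and let the $\epsilon$-thickened convex hull $\mathrm{hull}_\epsilon(\Gamma)$ be the smallest nonempty closed $\Gamma$-invariant convex subset of $\mathbb H^n$ that contains $\mathrm{Thin}_\epsilon(\Gamma)$, understood as the intersection of all such subsets. Lemma. For every $n\ge 1$ there is a constant $D=D(n)>0$ such that for every $\epsilon>0$ and every discrete subgroup $\Gamma<\mathrm{Isom}(\mathbb H^n)$, the set $\mathrm{hull}_\epsilon(\Gamma)$ is contained in the $D$-neighborhood of $\mathrm{hull}(\Gamma)\cup\mathrm{Thin}_\epsilon(\Gamma)$.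 -/

import Mathlib

/-- Points of hyperbolic `n`-space in the projective (Beltrami–Klein) model: the open unit ball of
Euclidean `n`-space. The sphere at infinity is the Euclidean unit sphere. -/
@[ext]
structure HypSpace (n : ℕ) where
  pt : EuclideanSpace ℝ (Fin n)
  norm_lt : ‖pt‖ < 1

namespace HypSpace

variable {n : ℕ}

/-- The hyperbolic cosine of the hyperbolic distance, in the projective model. -/
noncomputable def coshDist (x y : HypSpace n) : ℝ :=
  (1 - inner ℝ x.pt y.pt) / (√(1 - ‖x.pt‖ ^ 2) * √(1 - ‖y.pt‖ ^ 2))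

theorem lor_cs {E : Type*} [NormedAddCommGroup E] [InnerProductSpace ℝ E] {u v : E} {s t : ℝ}
    (hv : ‖v‖ ^ 2 = t ^ 2 - 1) (ho : inner ℝ u v = s * t) :
    s ^ 2 * t ^ 2 ≤ ‖u‖ ^ 2 * (t ^ 2 - 1) := by
  have h := real_inner_mul_inner_self_le u v
  rw [ho, real_inner_self_eq_norm_sq, real_inner_self_eq_norm_sq, hv] at h
  nlinarith

theorem lor_one_le {E : Type*} [NormedAddCommGroup E] [InnerProductSpace ℝ E] {u v : E} {s t : ℝ}
    (hs : 0 < s) (ht : 0 < t) (hu : ‖u‖ ^ 2 = s ^ 2 - 1) (hv : ‖v‖ ^ 2 = t ^ 2 - 1) :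
    1 ≤ s * t - inner ℝ u v := by
  have h1 := real_inner_le_norm u v
  have h3 : 1 ≤ s := by nlinarith [sq_nonneg ‖u‖]
  have h4 : 1 ≤ t := by nlinarith [sq_nonneg ‖v‖]
  have h2 : ‖u‖ * ‖v‖ ≤ s * t - 1 := by
    apply le_of_sq_le_sq _ (by nlinarith)
    rw [mul_pow, hu, hv]
    nlinarith [sq_nonneg (s - t)]
  linarith

theorem lor_eq {E : Type*} [NormedAddCommGroup E] [InnerProductSpace ℝ E] {u v : E} {s t : ℝ}
    (hu : ‖u‖ ^ 2 = s ^ 2 - 1) (hv : ‖v‖ ^ 2 = t ^ 2 - 1) (h : s * t - inner ℝ u v = 1) :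
    u = v ∧ s = t := by
  have ho : inner ℝ (u - v) v = (s - t) * t := by
    rw [inner_sub_left, real_inner_self_eq_norm_sq, hv]; linarith
  have h1 := lor_cs hv ho
  have h2 : ‖u - v‖ ^ 2 = (s - t) ^ 2 := by
    rw [norm_sub_sq_real, hu, hv]; linarith
  rw [h2] at h1
  have h3 : (s - t) ^ 2 = 0 := le_antisymm (by nlinarith) (sq_nonneg _)
  rw [h3] at h2
  exact ⟨by simpa [sub_eq_zero] using h2, by simpa [sub_eq_zero] using h3⟩

theorem lor_triangle {E : Type*} [NormedAddCommGroup E] [InnerProductSpace ℝ E] {u v w : E}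
    {s t r : ℝ} (ht : 0 < t)
    (hu : ‖u‖ ^ 2 = s ^ 2 - 1) (hv : ‖v‖ ^ 2 = t ^ 2 - 1) (hw : ‖w‖ ^ 2 = r ^ 2 - 1) :
    s * r - inner ℝ u w ≤ (s * t - inner ℝ u v) * (t * r - inner ℝ v w) +
      √((s * t - inner ℝ u v) ^ 2 - 1) * √((t * r - inner ℝ v w) ^ 2 - 1) := by
  obtain ⟨a, ha⟩ : ∃ a, a = s * t - inner ℝ u v := ⟨_, rfl⟩
  obtain ⟨b, hb⟩ : ∃ b, b = t * r - inner ℝ v w := ⟨_, rfl⟩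
  rw [← ha, ← hb]
  have ha' : inner ℝ u v = s * t - a := by linarith
  have hb' : inner ℝ v w = t * r - b := by linarith
  have ha'' : inner ℝ v u = s * t - a := by rw [real_inner_comm]; exact ha'
  have hb'' : inner ℝ w v = t * r - b := by rw [real_inner_comm]; exact hb'
  have hvv : inner ℝ v v = t ^ 2 - 1 := by rw [real_inner_self_eq_norm_sq, hv]
  have huu : inner ℝ u u = s ^ 2 - 1 := by rw [real_inner_self_eq_norm_sq, hu]
  have hww : inner ℝ w w = r ^ 2 - 1 := by rw [real_inner_self_eq_norm_sq, hw]
  have hwu : inner ℝ w u = (inner ℝ u w : ℝ) := real_inner_comm _ _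
  obtain ⟨Q, hQ⟩ : ∃ Q, Q = a * b - (s * r - inner ℝ u w) := ⟨_, rfl⟩
  have key : ∀ l : ℝ, 0 ≤ (b ^ 2 - 1) * (l * l) + (2 * Q) * l + (a ^ 2 - 1) := by
    intro l
    have ho : inner ℝ ((u - a • v) + l • (w - b • v)) v
        = ((s - a * t) + l * (r - b * t)) * t := by
      simp only [inner_add_left, inner_sub_left, inner_smul_left, ha', hb'', hvv,
        RCLike.conj_to_real]
      ring
    have h1 := lor_cs hv ho
    have h2 : ‖(u - a • v) + l • (w - b • v)‖ ^ 2 - ((s - a * t) + l * (r - b * t)) ^ 2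
        = (b ^ 2 - 1) * (l * l) + (2 * Q) * l + (a ^ 2 - 1) := by
      rw [← real_inner_self_eq_norm_sq, hQ]
      simp only [inner_add_left, inner_sub_left, inner_smul_left, inner_add_right,
        inner_sub_right, inner_smul_right, ha', hb', ha'', hb'', hvv, huu, hww, hwu,
        RCLike.conj_to_real]
      ring
    rw [← h2]
    have h3 : ((s - a * t) + l * (r - b * t)) ^ 2 * t ^ 2
        ≤ ‖(u - a • v) + l • (w - b • v)‖ ^ 2 * t ^ 2 := by
      nlinarith [sq_nonneg ‖(u - a • v) + l • (w - b • v)‖]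
    have := le_of_mul_le_mul_right h3 (by positivity)
    linarith
  have hd := discrim_le_zero key
  rw [discrim] at hd
  have hA : 0 ≤ a ^ 2 - 1 := by simpa using key 0
  have hfin : -Q ≤ √(a ^ 2 - 1) * √(b ^ 2 - 1) := by
    rw [← Real.sqrt_mul hA]
    apply Real.le_sqrt_of_sq_le
    nlinarith
  linarith

theorem one_sub_pos (x : HypSpace n) : 0 < 1 - ‖x.pt‖ ^ 2 := by
  nlinarith [norm_nonneg x.pt, x.norm_lt]

theorem lift_norm (x : HypSpace n) :
    ‖(√(1 - ‖x.pt‖ ^ 2))⁻¹ • x.pt‖ ^ 2 = ((√(1 - ‖x.pt‖ ^ 2))⁻¹) ^ 2 - 1 := by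
  have h := one_sub_pos x
  rw [norm_smul, mul_pow, Real.norm_eq_abs, sq_abs, inv_pow, Real.sq_sqrt h.le]
  field_simp
  ring

theorem lift_pos (x : HypSpace n) : 0 < (√(1 - ‖x.pt‖ ^ 2))⁻¹ :=
  inv_pos.mpr (Real.sqrt_pos.mpr (one_sub_pos x))

theorem coshDist_lift (x y : HypSpace n) :
    coshDist x y = (√(1 - ‖x.pt‖ ^ 2))⁻¹ * (√(1 - ‖y.pt‖ ^ 2))⁻¹ -
      inner ℝ ((√(1 - ‖x.pt‖ ^ 2))⁻¹ • x.pt) ((√(1 - ‖y.pt‖ ^ 2))⁻¹ • y.pt) := by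
  rw [coshDist, inner_smul_left, inner_smul_right, RCLike.conj_to_real, div_eq_mul_inv, mul_inv]
  ring

theorem one_le_coshDist (x y : HypSpace n) : 1 ≤ coshDist x y := by
  rw [coshDist_lift]
  exact lor_one_le (lift_pos x) (lift_pos y) (lift_norm x) (lift_norm y)

theorem coshDist_triangle (x y z : HypSpace n) :
    coshDist x z ≤ coshDist x y * coshDist y z +
      √(coshDist x y ^ 2 - 1) * √(coshDist y z ^ 2 - 1) := by
  rw [coshDist_lift x z, coshDist_lift x y, coshDist_lift y z]
  exact lor_triangle (lift_pos y) (lift_norm x) (lift_norm y) (lift_norm z)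

theorem coshDist_self (x : HypSpace n) : coshDist x x = 1 := by
  have h := one_sub_pos x
  rw [coshDist, Real.mul_self_sqrt h.le, real_inner_self_eq_norm_sq, div_self h.ne']

theorem coshDist_comm (x y : HypSpace n) : coshDist x y = coshDist y x := by
  rw [coshDist, coshDist, real_inner_comm, mul_comm]

theorem eq_of_coshDist (x y : HypSpace n) (h : coshDist x y = 1) : x = y := by
  rw [coshDist_lift] at h
  obtain ⟨h1, h2⟩ := lor_eq (lift_norm x) (lift_norm y) h
  rw [h2] at h1
  exact HypSpace.ext (smul_right_injective _ (lift_pos y).ne' h1)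

/-- The hyperbolic metric (curvature `-1`). -/
noncomputable instance : MetricSpace (HypSpace n) where
  dist x y := Real.arcosh (coshDist x y)
  dist_self x := by
    rw [coshDist_self, Real.arcosh_eq_zero_iff le_rfl]
  dist_comm x y := by
    rw [coshDist_comm]
  dist_triangle x y z := by
    have hxy := one_le_coshDist x y
    have hyz := one_le_coshDist y z
    have h0 := add_nonneg (Real.arcosh_nonneg hxy) (Real.arcosh_nonneg hyz)
    rw [← Real.arcosh_cosh h0, Real.arcosh_le_arcosh
      (by linarith [one_le_coshDist x z]) (Real.cosh_pos _), Real.cosh_add,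
      Real.cosh_arcosh hxy, Real.cosh_arcosh hyz, Real.sinh_arcosh hxy, Real.sinh_arcosh hyz]
    exact coshDist_triangle x y z
  eq_of_dist_eq_zero {x y} h :=
    eq_of_coshDist x y ((Real.arcosh_eq_zero_iff (one_le_coshDist x y)).mp h)

/-- The isometry group of hyperbolic space carries the compact-open topology. -/
noncomputable instance : TopologicalSpace (HypSpace n ≃ᵢ HypSpace n) :=
  TopologicalSpace.induced
    (fun g => (⟨g, g.continuous⟩ : C(HypSpace n, HypSpace n))) inferInstance

/-- Geodesic convexity: the geodesic segment `{z | d(x,z) + d(z,y) = d(x,y)}` between any two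
points of `A` lies in `A`. -/
def GeodConvex (A : Set (HypSpace n)) : Prop :=
  ∀ x ∈ A, ∀ y ∈ A, ∀ z, dist x z + dist z y = dist x y → z ∈ A

/-- `A` is `Γ`-invariant. -/
def Invariant (Γ : Subgroup (HypSpace n ≃ᵢ HypSpace n)) (A : Set (HypSpace n)) : Prop :=
  ∀ γ ∈ Γ, ∀ x ∈ A, γ x ∈ A

/-- The limit set: the points of the sphere at infinity that are limits of orbits of `Γ`. -/
def limitSet (Γ : Subgroup (HypSpace n ≃ᵢ HypSpace n)) : Set (EuclideanSpace ℝ (Fin n)) :=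
  {ξ | ‖ξ‖ = 1 ∧ ∃ x : HypSpace n, ξ ∈ closure {p | ∃ γ ∈ Γ, p = (γ x).pt}}

/-- `c` is a (unit speed) geodesic line with endpoints `ξ` and `η` at infinity. -/
def IsGeodesicLine (c : ℝ → HypSpace n) (ξ η : EuclideanSpace ℝ (Fin n)) : Prop :=
  Isometry c ∧ Filter.Tendsto (fun t => (c t).pt) Filter.atBot (nhds ξ) ∧
    Filter.Tendsto (fun t => (c t).pt) Filter.atTop (nhds η)

/-- The convex hull in hyperbolic space of a set `L` of points at infinity: the smallest convex set
that contains every geodesic line with both endpoints in `L`. It is empty if `L` has at most one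
point. -/
def hullAtInfinity (L : Set (EuclideanSpace ℝ (Fin n))) : Set (HypSpace n) :=
  ⋂₀ {C | GeodConvex C ∧ ∀ ξ ∈ L, ∀ η ∈ L, ∀ c, IsGeodesicLine c ξ η → Set.range c ⊆ C}

/-- `hull(Γ)`: the convex hull of the limit set. -/
def hull (Γ : Subgroup (HypSpace n ≃ᵢ HypSpace n)) : Set (HypSpace n) :=
  hullAtInfinity (limitSet Γ)

/-- `Thin_ε(Γ)`: the points moved by less than `ε` by some nontrivial element of `Γ`. -/
def thin (ε : ℝ) (Γ : Subgroup (HypSpace n ≃ᵢ HypSpace n)) : Set (HypSpace n) :=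
  {x | ∃ γ ∈ Γ, γ ≠ 1 ∧ dist x (γ x) < ε}

/-- `hull_ε(Γ)`: the smallest nonempty closed convex `Γ`-invariant set that contains `Thin_ε(Γ)`,
written as the intersection of all such sets. -/
def thickenedHull (ε : ℝ) (Γ : Subgroup (HypSpace n ≃ᵢ HypSpace n)) : Set (HypSpace n) :=
  ⋂₀ {C | C.Nonempty ∧ IsClosed C ∧ GeodConvex C ∧ Invariant Γ C ∧ thin ε Γ ⊆ C}

end HypSpace

/-! Call a set quasiconvex if geodesics between its points stay within a fixed distance of it. In
the Klein model geodesics are Euclidean segments, so the convex hull of a quasiconvex set consists,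
by Carathéodory, of points in simplices with at most `n + 1` vertices. Removing vertices one at a
time and using thin triangles keeps such points within a distance of the set that depends only on
`n` (`dist_convexHull_le`). The closed convex hull of an invariant set is again invariant, so it
suffices to show that `Y`, which is hull ∪ thin part or the thin part alone, is quasiconvex with a
universal constant.

Quasiconvexity comes from a hub: a convex set `H` of points and ideal points, whose finite points
lie in `closure Y`, such that each point of `Y` is joined to `H` by a segment inside `closure Y`.
Two thin triangles then suffice (`quasiconvex_of_hub`). A thin point `x` moved by `γ` reaches the
hub because the displacement set `{d(x, γ x) < ε}` is convex (`geodConvex_displacement_lt`). If the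
orbit of `x` under `⟨γ⟩` is unbounded, it stays in this set and accumulates at a limit point.
Otherwise `γ` fixes a point.

The hub depends on the limit set. With at least two limit points it is the closure of the hull,
which contains both the limit points and a fixed point of each such elliptic `γ`. With no limit
point it is a global fixed point. With a single limit point `ξ` it is `{ξ}`: `Γ` preserves the
Busemann function at `ξ` (`busemann_map`), so an elliptic element fixes a whole ray to `ξ`. In the
last two cases an empty thin part makes the thickened hull empty, by intersecting singletons or
shrinking horoballs. -/

namespace HypSpace

variable {n : ℕ}

open Filter Topology

/-! ### Metric and topology of the ball model -/

/-- The conformal weight `√(1 - ‖x‖²)` of a point. -/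
noncomputable def wt (x : HypSpace n) : ℝ := √(1 - ‖x.pt‖ ^ 2)

theorem wt_pos (x : HypSpace n) : 0 < wt x := Real.sqrt_pos.mpr (one_sub_pos x)

theorem wt_sq (x : HypSpace n) : wt x ^ 2 = 1 - ‖x.pt‖ ^ 2 := Real.sq_sqrt (one_sub_pos x).le

theorem wt_le_one (x : HypSpace n) : wt x ≤ 1 := by
  nlinarith [wt_sq x, wt_pos x, sq_nonneg ‖x.pt‖]

theorem one_sub_inner (x y : HypSpace n) :
    1 - inner ℝ x.pt y.pt = coshDist x y * (wt x * wt y) := by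
  rw [coshDist, ← wt, ← wt, div_mul_cancel₀]
  exact (mul_pos (wt_pos x) (wt_pos y)).ne'

theorem cosh_dist (x y : HypSpace n) : Real.cosh (dist x y) = coshDist x y :=
  Real.cosh_arcosh (one_le_coshDist x y)

theorem dist_le_iff {x y : HypSpace n} {r : ℝ} (hr : 0 ≤ r) :
    dist x y ≤ r ↔ coshDist x y ≤ Real.cosh r := by
  rw [← cosh_dist, Real.cosh_le_cosh, abs_of_nonneg dist_nonneg, abs_of_nonneg hr]

theorem dist_lt_iff {x y : HypSpace n} {r : ℝ} (hr : 0 ≤ r) :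
    dist x y < r ↔ coshDist x y < Real.cosh r := by
  rw [← cosh_dist, Real.cosh_lt_cosh, abs_of_nonneg dist_nonneg, abs_of_nonneg hr]

theorem coshDist_map (g : HypSpace n ≃ᵢ HypSpace n) (x y : HypSpace n) :
    coshDist (g x) (g y) = coshDist x y := by
  rw [← cosh_dist, ← cosh_dist, g.dist_eq]

theorem norm_sub_sq_le (x y : HypSpace n) :
    ‖x.pt - y.pt‖ ^ 2 ≤ 2 * (coshDist x y - 1) := by
  have h := one_sub_inner x y
  have hx := wt_sq x
  have hy := wt_sq y
  rw [norm_sub_sq_real]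
  have h1 : wt x * wt y ≤ 1 :=
    mul_le_one₀ (wt_le_one x) (wt_pos y).le (wt_le_one y)
  nlinarith [sq_nonneg (wt x - wt y), one_le_coshDist x y,
    mul_nonneg (sub_nonneg.2 (one_le_coshDist x y)) (sub_nonneg.2 h1)]

/-- The centre of the ball model. -/
def origin (n : ℕ) : HypSpace n := ⟨0, by simp⟩

theorem wt_origin : wt (origin n) = 1 := by simp [wt, origin]

theorem coshDist_origin (x : HypSpace n) : coshDist (origin n) x = (wt x)⁻¹ := by
  have h := one_sub_inner (origin n) x
  rw [wt_origin] at h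
  simp only [origin, inner_zero_left] at h ⊢
  have := wt_pos x
  field_simp
  linarith

theorem continuous_wt_aux {X : Type*} [TopologicalSpace X] {f : X → HypSpace n}
    (hf : Continuous fun t => (f t).pt) : Continuous fun t => wt (f t) := by
  unfold wt
  fun_prop

theorem tendsto_coshDist {X : Type*} {l : Filter X} {f g : X → HypSpace n} {x y : HypSpace n}
    (hf : Filter.Tendsto (fun t => (f t).pt) l (nhds x.pt))
    (hg : Filter.Tendsto (fun t => (g t).pt) l (nhds y.pt)) :
    Filter.Tendsto (fun t => coshDist (f t) (g t)) l (nhds (coshDist x y)) := by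
  unfold coshDist
  refine Filter.Tendsto.div ?_ ?_ (mul_pos (wt_pos x) (wt_pos y)).ne'
  · exact tendsto_const_nhds.sub (hf.inner hg)
  · exact ((tendsto_const_nhds.sub (hf.norm.pow 2)).sqrt).mul
      ((tendsto_const_nhds.sub (hg.norm.pow 2)).sqrt)

/-- Closures and compactness can thus be computed in Euclidean space, where the ideal points also
live. One direction is the estimate `norm_sub_sq_le`, the other the continuity of the formula for
`coshDist`. -/
theorem isInducing_pt : Topology.IsInducing (HypSpace.pt (n := n)) := by
  rw [Topology.isInducing_iff_nhds]
  intro x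
  apply le_antisymm
  · rw [← Filter.tendsto_iff_comap, tendsto_iff_norm_sub_tendsto_zero]
    have h1 : Filter.Tendsto (fun y : HypSpace n => dist y x) (nhds x) (nhds 0) := by
      have : Continuous fun y : HypSpace n => dist y x := by fun_prop
      simpa using this.tendsto x
    have h2 : Filter.Tendsto (fun y : HypSpace n => √(2 * (coshDist y x - 1))) (nhds x)
        (nhds 0) := by
      have := (((Real.continuous_cosh.tendsto 0).comp h1).sub_const 1).const_mul 2 |>.sqrt
      simpa [cosh_dist, Function.comp_def] using this
    refine squeeze_zero (fun _ => norm_nonneg _) (fun y => ?_) h2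
    exact Real.le_sqrt_of_sq_le (norm_sub_sq_le y x)
  · intro s hs
    obtain ⟨r, hr, hrs⟩ := Metric.mem_nhds_iff.1 hs
    have h1 : Filter.Tendsto (fun y : HypSpace n => coshDist y x)
        (Filter.comap HypSpace.pt (nhds x.pt)) (nhds (coshDist x x)) :=
      tendsto_coshDist Filter.tendsto_comap tendsto_const_nhds
    rw [coshDist_self] at h1
    have h2 := h1.eventually_lt_const (Real.one_lt_cosh.2 hr.ne')
    filter_upwards [h2] with y hy
    exact hrs ((dist_lt_iff hr.le).2 hy)

theorem continuous_pt : Continuous (HypSpace.pt (n := n)) := isInducing_pt.continuous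

theorem continuous_wt : Continuous (wt (n := n)) := continuous_wt_aux continuous_pt

theorem mem_closure_of_pt {A : Set (HypSpace n)} {z : HypSpace n}
    (h : z.pt ∈ closure (HypSpace.pt '' A)) : z ∈ closure A := by
  rw [isInducing_pt.closure_eq_preimage_closure_image]
  exact h

theorem isCompact_norm_le {r : ℝ} (hr : r < 1) : IsCompact {x : HypSpace n | ‖x.pt‖ ≤ r} := by
  rw [isInducing_pt.isCompact_iff]
  have : HypSpace.pt '' {x : HypSpace n | ‖x.pt‖ ≤ r} = Metric.closedBall 0 r := by
    ext u
    rw [mem_closedBall_zero_iff]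
    exact ⟨fun ⟨x, hx, e⟩ => e ▸ hx, fun h => ⟨⟨u, h.trans_lt hr⟩, h, rfl⟩⟩
  rw [this]
  exact isCompact_closedBall _ _

theorem isBounded_of_norm_le {r : ℝ} (hr : r < 1) {A : Set (HypSpace n)}
    (h : ∀ x ∈ A, ‖x.pt‖ ≤ r) : Bornology.IsBounded A :=
  (isCompact_norm_le hr).isBounded.subset h

theorem norm_le_of_wt_le {x : HypSpace n} {w : ℝ} (hw : 0 ≤ w) (h : w ≤ wt x) :
    ‖x.pt‖ ≤ √(1 - w ^ 2) := by
  apply Real.le_sqrt_of_sq_le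
  nlinarith [wt_sq x]

instance : ProperSpace (HypSpace n) := by
  refine ProperSpace.of_isCompact_closedBall_of_le 0 fun x r hr => ?_
  let R := dist x (origin n) + r
  have hR : 0 ≤ R := add_nonneg dist_nonneg hr
  have hw : 0 < (Real.cosh R)⁻¹ := inv_pos.2 (Real.cosh_pos _)
  have h1 : √(1 - (Real.cosh R)⁻¹ ^ 2) < 1 := by
    rw [Real.sqrt_lt' one_pos]
    nlinarith
  refine (isCompact_norm_le h1).of_isClosed_subset Metric.isClosed_closedBall fun y hy => ?_
  apply norm_le_of_wt_le hw.le
  rw [← inv_inv (wt y)]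
  apply inv_anti₀ (inv_pos.2 (wt_pos y))
  rw [← coshDist_origin, ← dist_le_iff hR]
  have := dist_triangle (origin n) x y
  rw [Metric.mem_closedBall, dist_comm] at hy
  rw [dist_comm (origin n) x] at this
  linarith

/-- An unbounded set of points accumulates on the sphere at infinity. -/
theorem exists_boundary_of_not_isBounded {A : Set (HypSpace n)} (hA : ¬ Bornology.IsBounded A) :
    ∃ ξ ∈ closure (HypSpace.pt '' A), ‖ξ‖ = 1 := by
  by_contra! h
  apply hA
  have hsub : closure (HypSpace.pt '' A) ⊆ Metric.closedBall 0 1 := by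
    apply closure_minimal _ Metric.isClosed_closedBall
    rintro _ ⟨x, -, rfl⟩
    simpa using x.norm_lt.le
  have hc : IsCompact (closure (HypSpace.pt '' A)) :=
    (isCompact_closedBall _ _).of_isClosed_subset isClosed_closure hsub
  rcases A.eq_empty_or_nonempty with rfl | hne
  · simp
  obtain ⟨u, hu, hmax⟩ := hc.exists_isMaxOn ((hne.image _).closure) continuous_norm.continuousOn
  have hu1 : ‖u‖ < 1 := lt_of_le_of_ne (by simpa using hsub hu) (h u hu)
  exact isBounded_of_norm_le hu1 fun x hx => hmax (subset_closure ⟨x, hx, rfl⟩)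

/-! ### Geodesic segments as Euclidean segments -/

theorem norm_lt_of_mem_segment {x y : HypSpace n} {u : EuclideanSpace ℝ (Fin n)}
    (h : u ∈ segment ℝ x.pt y.pt) : ‖u‖ < 1 := by
  have := (convex_ball (0 : EuclideanSpace ℝ (Fin n)) 1).segment_subset
    (by simpa using x.norm_lt) (by simpa using y.norm_lt) h
  simpa using this

/-- Points of the segment from `x` to `y` are, on the hyperboloid, nonnegative combinations. -/
theorem exists_coeff {x y z : HypSpace n} (h : z.pt ∈ segment ℝ x.pt y.pt) :
    ∃ a b : ℝ, 0 ≤ a ∧ 0 ≤ b ∧ ∀ w, coshDist z w = a * coshDist x w + b * coshDist y w := by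
  obtain ⟨s, t, hs, ht, hst, e⟩ := h
  have hz := wt_pos z
  refine ⟨s * wt x / wt z, t * wt y / wt z, by have := wt_pos x; positivity,
    by have := wt_pos y; positivity, fun w => ?_⟩
  have h1 := one_sub_inner z w
  have h2 := one_sub_inner x w
  have h3 := one_sub_inner y w
  rw [← e, inner_add_left, inner_smul_left, inner_smul_left] at h1
  simp only [RCLike.conj_to_real] at h1
  have hw := wt_pos w
  have h4 : coshDist z w * wt z * wt w =
      (s * (coshDist x w * wt x) + t * (coshDist y w * wt y)) * wt w := by
    have : s = 1 - t := by linarith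
    subst this
    linear_combination (-1) * h1 + (1 - t) * h2 + t * h3
  have h5 := mul_right_cancel₀ hw.ne' h4
  field_simp
  linarith

/-- A nonnegative combination of two hyperboloid vectors is timelike; `r` is its Lorentz norm and
`z` its radial projection. -/
theorem exists_of_coeff (x y : HypSpace n) {a b : ℝ} (ha : 0 ≤ a) (hb : 0 ≤ b) (hab : 0 < a + b) :
    ∃ z : HypSpace n, ∃ r : ℝ, 0 < r ∧ z.pt ∈ segment ℝ x.pt y.pt ∧
      ∀ w, r * coshDist z w = a * coshDist x w + b * coshDist y w := by
  have hx := wt_pos x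
  have hy := wt_pos y
  have hd : 0 < a / wt x + b / wt y := by
    rcases ha.eq_or_lt with rfl | ha
    · have : 0 < b := by linarith
      positivity
    · positivity
  set d := a / wt x + b / wt y
  have hmem : (a / wt x / d) • x.pt + (b / wt y / d) • y.pt ∈ segment ℝ x.pt y.pt :=
    ⟨_, _, by positivity, by positivity, by rw [← add_div, div_self hd.ne'], rfl⟩
  let z : HypSpace n := ⟨_, norm_lt_of_mem_segment hmem⟩
  have hz := wt_pos z
  refine ⟨z, d * wt z, by positivity, hmem, fun w => ?_⟩
  have h1 := one_sub_inner z w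
  have h2 := one_sub_inner x w
  have h3 := one_sub_inner y w
  have e : z.pt = (a / wt x / d) • x.pt + (b / wt y / d) • y.pt := rfl
  rw [e, inner_add_left, inner_smul_left, inner_smul_left] at h1
  simp only [RCLike.conj_to_real] at h1
  have hw := wt_pos w
  apply mul_right_cancel₀ hw.ne'
  have h4 : d * (1 - (a / wt x / d * inner ℝ x.pt w.pt + b / wt y / d * inner ℝ y.pt w.pt))
      = a / wt x * (1 - inner ℝ x.pt w.pt) + b / wt y * (1 - inner ℝ y.pt w.pt) := by
    have : d = a / wt x + b / wt y := rfl
    field_simp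
    rw [this]
    field_simp
    ring
  rw [h1, h2, h3] at h4
  have h5 : a / wt x * (coshDist x w * (wt x * wt w)) = a * coshDist x w * wt w := by
    field_simp
  have h6 : b / wt y * (coshDist y w * (wt y * wt w)) = b * coshDist y w * wt w := by
    field_simp
  rw [h5, h6] at h4
  linarith

/-- A point that pairs like a normalized combination is that combination. -/
theorem mem_segment_of_coeff {x y z : HypSpace n} {a b : ℝ} (ha : 0 ≤ a) (hb : 0 ≤ b)
    (hn : a ^ 2 + b ^ 2 + 2 * a * b * coshDist x y = 1)
    (hz : a * coshDist x z + b * coshDist y z = 1) :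
    z.pt ∈ segment ℝ x.pt y.pt ∧
      ∀ w, coshDist z w = a * coshDist x w + b * coshDist y w := by
  have hab : 0 < a + b := by
    rcases (add_nonneg ha hb).eq_or_lt with h | h
    · have h1 : a = 0 := by linarith
      have h2 : b = 0 := by linarith
      simp [h1, h2] at hn
    · exact h
  obtain ⟨z', r, hr, hseg, h⟩ := exists_of_coeff x y ha hb hab
  have h1 := h z'
  have h2 := h x
  have h3 := h y
  rw [coshDist_self] at h1 h2 h3
  rw [coshDist_comm z' x, coshDist_comm y x] at h2
  rw [coshDist_comm z' y] at h3
  have hr1 : r = 1 := by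
    have : r ^ 2 = 1 := by
      linear_combination hn + r * h1 + a * h2 + b * h3
    nlinarith
  subst hr1
  have : z' = z := by
    apply eq_of_coshDist
    have := h z
    rw [hz] at this
    linarith
  subst this
  exact ⟨hseg, fun w => by rw [← h w, one_mul]⟩

theorem coeff_norm {x y z : HypSpace n} {a b : ℝ}
    (h : ∀ w, coshDist z w = a * coshDist x w + b * coshDist y w) :
    a ^ 2 + b ^ 2 + 2 * a * b * coshDist x y = 1 := by
  have h1 := h z
  have h2 := h x
  have h3 := h y
  rw [coshDist_self] at h1 h2 h3
  rw [coshDist_comm z x, coshDist_comm y x] at h2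
  rw [coshDist_comm z y] at h3
  linear_combination (-1) * h1 - a * h2 - b * h3

/-- Isometries act linearly on the hyperboloid. -/
theorem coeff_map (g : HypSpace n ≃ᵢ HypSpace n) {x y z : HypSpace n} {a b : ℝ} (ha : 0 ≤ a)
    (hb : 0 ≤ b) (h : ∀ w, coshDist z w = a * coshDist x w + b * coshDist y w) (w : HypSpace n) :
    coshDist (g z) w = a * coshDist (g x) w + b * coshDist (g y) w := by
  refine (mem_segment_of_coeff (x := g x) (y := g y) ha hb ?_ ?_).2 w
  · rw [coshDist_map]; exact coeff_norm h
  · rw [coshDist_map, coshDist_map, ← h z, coshDist_self]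

theorem mem_segment_of_dist {x y z : HypSpace n} (h : dist x z + dist z y = dist x y) :
    z.pt ∈ segment ℝ x.pt y.pt := by
  rcases (dist_nonneg (x := x) (y := y)).eq_or_lt with h0 | h0
  · have : x = z := by
      apply dist_le_zero.1
      linarith [dist_nonneg (x := z) (y := y)]
    subst this
    exact left_mem_segment ℝ _ _
  have hs : 0 < Real.sinh (dist x y) := Real.sinh_pos_iff.2 h0
  have e1 := Real.sinh_add (dist x z) (dist z y)
  have e2 := Real.cosh_add (dist x z) (dist z y)
  have e3 := Real.cosh_sq (dist x z)
  have e4 := Real.cosh_sq (dist z y)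
  rw [h] at e1 e2
  have p1 : 0 ≤ Real.sinh (dist x z) := Real.sinh_nonneg_iff.2 dist_nonneg
  have p2 : 0 ≤ Real.sinh (dist z y) := Real.sinh_nonneg_iff.2 dist_nonneg
  have hne := hs.ne'
  -- Along a geodesic the hyperboloid vector is the combination of the end vectors with these
  -- hyperbolic sine weights.
  refine (mem_segment_of_coeff (a := Real.sinh (dist z y) / Real.sinh (dist x y))
    (b := Real.sinh (dist x z) / Real.sinh (dist x y)) (by positivity) (by positivity) ?_ ?_).1
  · rw [← cosh_dist, e2]
    field_simp
    rw [e1]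
    linear_combination (-Real.sinh (dist z y) ^ 2) * e3 - Real.sinh (dist x z) ^ 2 * e4
  · rw [← cosh_dist, ← cosh_dist, dist_comm y z]
    field_simp
    rw [e1]
    ring

theorem dist_of_mem_segment {x y z : HypSpace n} (h : z.pt ∈ segment ℝ x.pt y.pt) :
    dist x z + dist z y = dist x y := by
  obtain ⟨a, b, ha, hb, hc⟩ := exists_coeff h
  have hn := coeff_norm hc
  have h2 := hc x
  have h3 := hc y
  rw [coshDist_self] at h2 h3
  rw [coshDist_comm z x, coshDist_comm y x] at h2
  set c := coshDist x y with hcdef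
  have hc1 : 1 ≤ c := one_le_coshDist x y
  have hs1 : Real.sinh (dist x z) = b * √(c ^ 2 - 1) := by
    have hp : 0 ≤ Real.sinh (dist x z) := Real.sinh_nonneg_iff.2 dist_nonneg
    apply (sq_eq_sq₀ hp (by positivity)).1
    rw [mul_pow, Real.sq_sqrt (by nlinarith), Real.sinh_sq, cosh_dist, h2]
    linear_combination hn
  have hs2 : Real.sinh (dist z y) = a * √(c ^ 2 - 1) := by
    have hp : 0 ≤ Real.sinh (dist z y) := Real.sinh_nonneg_iff.2 dist_nonneg
    apply (sq_eq_sq₀ hp (by positivity)).1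
    rw [mul_pow, Real.sq_sqrt (by nlinarith), Real.sinh_sq, cosh_dist, h3]
    linear_combination hn
  apply Real.cosh_injOn (Set.mem_Ici.2 (by positivity)) (Set.mem_Ici.2 dist_nonneg)
  rw [Real.cosh_add, hs1, hs2, cosh_dist, cosh_dist, cosh_dist, h2, h3, ← hcdef]
  have hq : √(c ^ 2 - 1) * √(c ^ 2 - 1) = c ^ 2 - 1 := Real.mul_self_sqrt (by nlinarith)
  linear_combination c * hn + a * b * hq

theorem geodConvex_iff {A : Set (HypSpace n)} : GeodConvex A ↔ Convex ℝ (HypSpace.pt '' A) := by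
  rw [convex_iff_segment_subset]
  constructor
  · rintro h _ ⟨x, hx, rfl⟩ _ ⟨y, hy, rfl⟩ u hu
    exact ⟨⟨u, norm_lt_of_mem_segment hu⟩, h x hx y hy _ (dist_of_mem_segment hu), rfl⟩
  · intro h x hx y hy z hz
    obtain ⟨z', hz', e⟩ := h ⟨x, hx, rfl⟩ ⟨y, hy, rfl⟩ (mem_segment_of_dist hz)
    exact HypSpace.ext e ▸ hz'

theorem geodConvex_preimage_pt {K : Set (EuclideanSpace ℝ (Fin n))} (hK : Convex ℝ K) :
    GeodConvex {z : HypSpace n | z.pt ∈ K} := fun _ hx _ hy _ hz =>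
  hK.segment_subset hx hy (mem_segment_of_dist hz)

theorem GeodConvex.closure {A : Set (HypSpace n)} (h : GeodConvex A) :
    GeodConvex (closure A) := by
  rw [isInducing_pt.closure_eq_preimage_closure_image]
  exact geodConvex_preimage_pt (geodConvex_iff.1 h).closure

theorem GeodConvex.preimage {A : Set (HypSpace n)} (h : GeodConvex A)
    (g : HypSpace n ≃ᵢ HypSpace n) : GeodConvex (g ⁻¹' A) := fun x hx y hy z hz =>
  h _ hx _ hy _ (by simpa [g.dist_eq] using hz)

theorem GeodConvex.sInter {F : Set (Set (HypSpace n))} (h : ∀ A ∈ F, GeodConvex A) :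
    GeodConvex (⋂₀ F) := fun x hx y hy z hz A hA =>
  h A hA x (hx A hA) y (hy A hA) z hz

/-! ### Thin triangles with ideal vertices allowed -/

section ThinTriangles

variable {E : Type*} [NormedAddCommGroup E] [InnerProductSpace ℝ E]

theorem one_sub_inner_nonneg {a b : E} (ha : ‖a‖ ≤ 1) (hb : ‖b‖ ≤ 1) :
    0 ≤ 1 - (inner ℝ a b : ℝ) := by
  nlinarith [real_inner_le_norm a b, norm_nonneg a, norm_nonneg b]

theorem one_sub_inner_pos {a b : E} (ha : ‖a‖ < 1) (hb : ‖b‖ ≤ 1) :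
    0 < 1 - (inner ℝ a b : ℝ) := by
  nlinarith [real_inner_le_norm a b, norm_nonneg a, norm_nonneg b]

end ThinTriangles

/-- Everything is expressed through the products `1 - ⟪u, v⟫`, which still make sense, and may
vanish, at ideal vertices. The hypothesis `hle` selects the side of the triangle to which `z` is
close. -/
theorem thin_triangle_aux {a b c : EuclideanSpace ℝ (Fin n)} (ha : ‖a‖ ≤ 1) (hb : ‖b‖ ≤ 1)
    (hc : ‖c‖ ≤ 1) {s t : ℝ} (hs : 0 ≤ s) (ht : 0 ≤ t) (hst : s + t = 1) {z : HypSpace n}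
    (hz : z.pt = s • a + t • b)
    (hle : t * (1 - inner ℝ b c) ≤ s * (1 - inner ℝ a c)) :
    ∃ w : HypSpace n, w.pt ∈ segment ℝ a c ∧ coshDist z w ≤ 3 / 2 := by
  have hzc := one_sub_inner_pos z.norm_lt hc
  have haa := one_sub_inner_nonneg ha ha
  have hbb := one_sub_inner_nonneg hb hb
  have hcc := one_sub_inner_nonneg hc hc
  have hab := one_sub_inner_nonneg ha hb
  have hac := one_sub_inner_nonneg ha hc
  have hzz := one_sub_pos z
  have ht' : t = 1 - s := by linarith
  obtain ⟨kaa, ekaa⟩ : ∃ k, k = 1 - (inner ℝ a a : ℝ) := ⟨_, rfl⟩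
  obtain ⟨kbb, ekbb⟩ : ∃ k, k = 1 - (inner ℝ b b : ℝ) := ⟨_, rfl⟩
  obtain ⟨kcc, ekcc⟩ : ∃ k, k = 1 - (inner ℝ c c : ℝ) := ⟨_, rfl⟩
  obtain ⟨kab, ekab⟩ : ∃ k, k = 1 - (inner ℝ a b : ℝ) := ⟨_, rfl⟩
  obtain ⟨kac, ekac⟩ : ∃ k, k = 1 - (inner ℝ a c : ℝ) := ⟨_, rfl⟩
  obtain ⟨kbc, ekbc⟩ : ∃ k, k = 1 - (inner ℝ b c : ℝ) := ⟨_, rfl⟩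
  have ezc : 1 - (inner ℝ z.pt c : ℝ) = s * kac + t * kbc := by
    rw [hz, inner_add_left, inner_smul_left, inner_smul_left]
    simp only [RCLike.conj_to_real]
    rw [ekac, ekbc, ht']; ring
  have ezz : 1 - ‖z.pt‖ ^ 2 = s ^ 2 * kaa + t ^ 2 * kbb + 2 * s * t * kab := by
    rw [← real_inner_self_eq_norm_sq, hz]
    simp only [inner_add_left, inner_add_right, inner_smul_left, inner_smul_right,
      RCLike.conj_to_real, real_inner_comm a b]
    rw [ekaa, ekbb, ekab, ht']; ring
  rw [ezc] at hzc
  rw [← ekaa] at haa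
  rw [← ekbb] at hbb
  rw [← ekcc] at hcc
  rw [← ekab] at hab
  rw [← ekac] at hac hle
  rw [← ekbc] at hle
  have hsk : 0 < s * kac := by linarith
  have hs0 : 0 < s := by
    rcases hs.eq_or_lt with h | h
    · rw [← h] at hsk; simp at hsk
    · exact h
  have hk0 : 0 < kac := by
    rcases hac.eq_or_lt with h | h
    · rw [← h] at hsk; simp at hsk
    · exact h
  -- `F` will bound from below the squared Lorentz norms of both `s a + t b` and `s a + μ c`. The
  -- pairing of these two vectors is at most `s² kaa + 3 s t kab ≤ 3/2 F`, whence the constant.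
  obtain ⟨F, eF⟩ : ∃ F, F = s ^ 2 * kaa + 2 * s * t * kab := ⟨_, rfl⟩
  have hF : 0 < F := by
    rw [ezz] at hzz
    have h1 : 0 ≤ s ^ 2 * kaa := by positivity
    have h2 : 0 ≤ 2 * s * t * kab := by positivity
    rcases (add_nonneg h1 h2).eq_or_lt with h | h
    · exfalso
      have h3 : 0 < t ^ 2 * kbb := by linarith
      have ht0 : 0 < t := by
        rcases ht.eq_or_lt with h | h
        · rw [← h] at h3; simp at h3
        · exact h
      have hb0 : 0 < kbb := by
        rcases hbb.eq_or_lt with h | h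
        · rw [← h] at h3; simp at h3
        · exact h
      have hb1 : ‖b‖ < 1 := by
        rw [ekbb, real_inner_self_eq_norm_sq] at hb0
        nlinarith [norm_nonneg b]
      have h4 : 0 < kab := by
        rw [ekab, real_inner_comm]; exact one_sub_inner_pos hb1 ha
      have h5 : 0 < 2 * s * t * kab := by positivity
      linarith
    · rw [eF]; exact h
  -- The weight of `c` is chosen so that `s a + μ c` has the same cross term, `2 s μ kac = 2 s t
  -- kab`, as `s a + t b`.
  obtain ⟨μ, eμ⟩ : ∃ μ, μ = t * kab / kac := ⟨_, rfl⟩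
  have hμ0 : 0 ≤ μ := by rw [eμ]; positivity
  have hμ : μ * kac = t * kab := by rw [eμ]; field_simp
  have hd : 0 < s + μ := by linarith
  obtain ⟨w, ew⟩ : ∃ w, w = (s / (s + μ)) • a + (μ / (s + μ)) • c := ⟨_, rfl⟩
  have eww : (s + μ) ^ 2 * (1 - ‖w‖ ^ 2) = s ^ 2 * kaa + 2 * s * μ * kac + μ ^ 2 * kcc := by
    rw [← real_inner_self_eq_norm_sq, ew]
    simp only [inner_add_left, inner_add_right, inner_smul_left, inner_smul_right,
      RCLike.conj_to_real, real_inner_comm a c]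
    rw [ekaa, ekac, ekcc]; field_simp; ring
  have ezw : (s + μ) * (1 - inner ℝ z.pt w) =
      s ^ 2 * kaa + s * t * kab + μ * (s * kac + t * kbc) := by
    rw [hz, ew]
    simp only [inner_add_left, inner_add_right, inner_smul_left, inner_smul_right,
      RCLike.conj_to_real, real_inner_comm a b]
    rw [ekaa, ekab, ekac, ekbc, ht']; field_simp; ring
  have hFw : F ≤ (s + μ) ^ 2 * (1 - ‖w‖ ^ 2) := by
    rw [eww, eF]
    have : 2 * s * μ * kac = 2 * s * t * kab := by linear_combination 2 * s * hμ
    have h2 : 0 ≤ μ ^ 2 * kcc := by positivity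
    linarith
  have hw1 : 0 < 1 - ‖w‖ ^ 2 := by
    by_contra! h
    have : (s + μ) ^ 2 * (1 - ‖w‖ ^ 2) ≤ 0 := mul_nonpos_of_nonneg_of_nonpos (by positivity) h
    linarith
  have hwn : ‖w‖ < 1 := by nlinarith [norm_nonneg w]
  refine ⟨⟨w, hwn⟩, ⟨_, _, by positivity, by positivity, by field_simp, ew.symm⟩, ?_⟩
  have hnum : (s + μ) * (1 - inner ℝ z.pt w) ≤ 3 / 2 * F := by
    rw [ezw, eF]
    have h1 : μ * (t * kbc) ≤ μ * (s * kac) := mul_le_mul_of_nonneg_left hle hμ0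
    have h2 : μ * (s * kac) = s * t * kab := by linear_combination s * hμ
    have h3 : 0 ≤ s ^ 2 * kaa := by positivity
    linarith
  have hFz : F ≤ 1 - ‖z.pt‖ ^ 2 := by
    rw [ezz, eF]
    have : 0 ≤ t ^ 2 * kbb := by positivity
    linarith
  rw [coshDist, div_le_iff₀ (mul_pos (Real.sqrt_pos.2 hzz) (Real.sqrt_pos.2 hw1))]
  have h1 : √F ≤ √(1 - ‖z.pt‖ ^ 2) := Real.sqrt_le_sqrt hFz
  have h2 : √F ≤ (s + μ) * √(1 - ‖w‖ ^ 2) := by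
    rw [← Real.sqrt_sq hd.le, ← Real.sqrt_mul (by positivity)]
    exact Real.sqrt_le_sqrt hFw
  have h3 : F ≤ √(1 - ‖z.pt‖ ^ 2) * ((s + μ) * √(1 - ‖w‖ ^ 2)) := by
    calc F = √F * √F := (Real.mul_self_sqrt hF.le).symm
      _ ≤ _ := mul_le_mul h1 h2 (Real.sqrt_nonneg _) (Real.sqrt_nonneg _)
  refine le_of_mul_le_mul_left ?_ hd
  calc _ ≤ 3 / 2 * F := hnum
    _ ≤ 3 / 2 * (√(1 - ‖z.pt‖ ^ 2) * ((s + μ) * √(1 - ‖w‖ ^ 2))) := by linarith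
    _ = _ := by ring

/-- The thinness constant of geodesic triangles, ideal vertices allowed. -/
noncomputable def thinness : ℝ := Real.arcosh (3 / 2)

theorem thinness_pos : 0 < thinness := Real.arcosh_pos (by norm_num)

theorem thin_triangle {a b c : EuclideanSpace ℝ (Fin n)} (ha : ‖a‖ ≤ 1) (hb : ‖b‖ ≤ 1)
    (hc : ‖c‖ ≤ 1) {z : HypSpace n} (hz : z.pt ∈ segment ℝ a b) :
    ∃ w : HypSpace n, (w.pt ∈ segment ℝ a c ∨ w.pt ∈ segment ℝ b c) ∧ dist z w ≤ thinness := by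
  have key : ∀ w : HypSpace n, coshDist z w ≤ 3 / 2 → dist z w ≤ thinness := fun w hw => by
    rw [dist_le_iff thinness_pos.le, thinness, Real.cosh_arcosh (by norm_num)]
    exact hw
  obtain ⟨s, t, hs, ht, hst, e⟩ := hz
  rcases le_total (t * (1 - inner ℝ b c)) (s * (1 - inner ℝ a c)) with h | h
  · obtain ⟨w, hw, hd⟩ := thin_triangle_aux ha hb hc hs ht hst e.symm h
    exact ⟨w, Or.inl hw, key w hd⟩
  · obtain ⟨w, hw, hd⟩ := thin_triangle_aux hb ha hc ht hs (by linarith)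
      (by rw [← e, add_comm]) h
    exact ⟨w, Or.inr hw, key w hd⟩

/-! ### The Lorentz form and convexity of displacement -/

section Lorentz

variable {E : Type*} [NormedAddCommGroup E] [InnerProductSpace ℝ E]

/-- The Lorentz form on `E × ℝ`. -/
noncomputable def lor (a b : E × ℝ) : ℝ := a.2 * b.2 - inner ℝ a.1 b.1

theorem lor_comm (a b : E × ℝ) : lor a b = lor b a := by
  rw [lor, lor, real_inner_comm, mul_comm]

theorem lor_add_left (a b c : E × ℝ) : lor (a + b) c = lor a c + lor b c := by
  simp only [lor, Prod.fst_add, Prod.snd_add, inner_add_left]; ring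

theorem lor_smul_left (r : ℝ) (a c : E × ℝ) : lor (r • a) c = r * lor a c := by
  simp only [lor, Prod.smul_fst, Prod.smul_snd, inner_smul_left, RCLike.conj_to_real, smul_eq_mul]
  ring

theorem lor_sub_left (a b c : E × ℝ) : lor (a - b) c = lor a c - lor b c := by
  simp only [lor, Prod.fst_sub, Prod.snd_sub, inner_sub_left]; ring

theorem lor_add_right (a b c : E × ℝ) : lor a (b + c) = lor a b + lor a c := by
  rw [lor_comm, lor_add_left, lor_comm b, lor_comm c]

theorem lor_smul_right (r : ℝ) (a c : E × ℝ) : lor a (r • c) = r * lor a c := by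
  rw [lor_comm, lor_smul_left, lor_comm c]

theorem lor_sub_right (a b c : E × ℝ) : lor a (b - c) = lor a b - lor a c := by
  rw [lor_comm, lor_sub_left, lor_comm b, lor_comm c]

/-- The orthogonal complement of a timelike vector is negative semidefinite, by Cauchy–Schwarz in
`E`. -/
theorem lor_self_nonpos {S P : E × ℝ} (hS : 0 < lor S S) (h : lor P S = 0) : lor P P ≤ 0 := by
  have h1 := real_inner_mul_inner_self_le P.1 S.1
  simp only [lor, real_inner_self_eq_norm_sq] at *
  have h2 : inner ℝ P.1 S.1 = P.2 * S.2 := by linarith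
  rw [h2] at h1
  have h3 : P.2 ^ 2 * S.2 ^ 2 ≤ ‖P.1‖ ^ 2 * S.2 ^ 2 := by
    nlinarith [sq_nonneg ‖P.1‖]
  have h4 : 0 < S.2 ^ 2 := by nlinarith [sq_nonneg ‖S.1‖]
  have := le_of_mul_le_mul_right h3 h4
  linarith

/-- Cauchy–Schwarz on the orthogonal complement of a timelike vector. -/
theorem lor_cauchy {S P Q : E × ℝ} (hS : 0 < lor S S) (hP : lor P S = 0) (hQ : lor Q S = 0) :
    lor P Q ^ 2 ≤ lor P P * lor Q Q := by
  have key : ∀ l : ℝ, 0 ≤ -lor Q Q * (l * l) + (-2 * lor P Q) * l + -lor P P := by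
    intro l
    have h := lor_self_nonpos (P := P + l • Q) hS
      (by rw [lor_add_left, lor_smul_left, hP, hQ]; ring)
    simp only [lor_add_left, lor_add_right, lor_smul_left, lor_smul_right] at h
    rw [lor_comm Q P] at h
    linarith
  have := discrim_le_zero key
  rw [discrim] at this
  linarith

/-- Apply `lor_cauchy` twice: in the complement of `S`, to `P` and the projection of `Q`; in the
complement of `T`, to `Q` and the projection of `S`. Eliminating `lor Q S` leaves the claim. -/
theorem lor_cauchy_timelike {S T P Q : E × ℝ} (hS : 0 < lor S S) (hT : 0 < lor T T)
    (hP : lor P S = 0) (hQ : lor Q T = 0) :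
    lor P Q ^ 2 * (lor S S * lor T T) ≤ lor P P * lor Q Q * lor S T ^ 2 := by
  have hPP := lor_self_nonpos hS hP
  have hQQ := lor_self_nonpos hT hQ
  have h1 := lor_cauchy (P := P) (Q := lor S S • Q - lor Q S • S) hS hP
    (by rw [lor_sub_left, lor_smul_left, lor_smul_left]; ring)
  have h2 := lor_cauchy (P := Q) (Q := lor T T • S - lor S T • T) hT hQ
    (by rw [lor_sub_left, lor_smul_left, lor_smul_left]; ring)
  simp only [lor_sub_left, lor_sub_right, lor_smul_left, lor_smul_right, hP, hQ] at h1 h2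
  rw [lor_comm S Q] at h1
  rw [lor_comm T S] at h2
  generalize lor P Q = pq at *
  generalize lor S S = ss at *
  generalize lor T T = tt at *
  generalize lor P P = pp at *
  generalize lor Q Q = qq at *
  generalize lor S T = st at *
  generalize lor Q S = qs at *
  have h3 : qs ^ 2 * tt ≤ qq * (ss * tt - st ^ 2) := by
    have : tt * (qs ^ 2 * tt) ≤ tt * (qq * (ss * tt - st ^ 2)) := by linarith
    exact le_of_mul_le_mul_left this hT
  have h4 : pq ^ 2 * ss ≤ pp * (ss * qq - qs ^ 2) := by
    have : ss * (pq ^ 2 * ss) ≤ ss * (pp * (ss * qq - qs ^ 2)) := by linarith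
    exact le_of_mul_le_mul_left this hS
  have h5 : pq ^ 2 * ss * tt ≤ pp * (ss * qq - qs ^ 2) * tt :=
    mul_le_mul_of_nonneg_right h4 hT.le
  have h6 : -pp * (qs ^ 2 * tt) ≤ -pp * (qq * (ss * tt - st ^ 2)) :=
    mul_le_mul_of_nonneg_left h3 (by linarith)
  linarith

end Lorentz

/-- The lift of a point to the hyperboloid. -/
noncomputable def lift (x : HypSpace n) : EuclideanSpace ℝ (Fin n) × ℝ :=
  ((√(1 - ‖x.pt‖ ^ 2))⁻¹ • x.pt, (√(1 - ‖x.pt‖ ^ 2))⁻¹)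

theorem lor_lift (x y : HypSpace n) : lor (lift x) (lift y) = coshDist x y :=
  (coshDist_lift x y).symm

/-- The diagonals of a quadrilateral with two opposite sides of equal length. -/
theorem coshDist_diagonals {x y x' y' : HypSpace n} (h : coshDist x' y' = coshDist x y) {M : ℝ}
    (hx : coshDist x x' ≤ M) (hy : coshDist y y' ≤ M) :
    coshDist x y' + coshDist x' y ≤ 2 * M * coshDist x y := by
  -- Sum and difference of two hyperboloid vectors are orthogonal, and the sum is timelike:
  -- `lor_cauchy_timelike` applies to the pairs `x, x'` and `y, y'`.
  have hS : lor (lift x + lift x') (lift x + lift x') = 2 + 2 * coshDist x x' := by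
    simp only [lor_add_left, lor_add_right, lor_lift, coshDist_self, coshDist_comm x' x]; ring
  have hT : lor (lift y + lift y') (lift y + lift y') = 2 + 2 * coshDist y y' := by
    simp only [lor_add_left, lor_add_right, lor_lift, coshDist_self, coshDist_comm y' y]; ring
  have hP : lor (lift x - lift x') (lift x - lift x') = 2 - 2 * coshDist x x' := by
    simp only [lor_sub_left, lor_sub_right, lor_lift, coshDist_self, coshDist_comm x' x]; ring
  have hQ : lor (lift y - lift y') (lift y - lift y') = 2 - 2 * coshDist y y' := by
    simp only [lor_sub_left, lor_sub_right, lor_lift, coshDist_self, coshDist_comm y' y]; ring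
  have hPS : lor (lift x - lift x') (lift x + lift x') = 0 := by
    simp only [lor_sub_left, lor_add_right, lor_lift, coshDist_self, coshDist_comm x' x]; ring
  have hQT : lor (lift y - lift y') (lift y + lift y') = 0 := by
    simp only [lor_sub_left, lor_add_right, lor_lift, coshDist_self, coshDist_comm y' y]; ring
  have hST : lor (lift x + lift x') (lift y + lift y') =
      2 * coshDist x y + (coshDist x y' + coshDist x' y) := by
    simp only [lor_add_left, lor_add_right, lor_lift, h]; ring
  have hPQ : lor (lift x - lift x') (lift y - lift y') =
      2 * coshDist x y - (coshDist x y' + coshDist x' y) := by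
    simp only [lor_sub_left, lor_sub_right, lor_lift, h]; ring
  have ha := one_le_coshDist x x'
  have hb := one_le_coshDist y y'
  have hh := one_le_coshDist x y
  have key := lor_cauchy_timelike (by rw [hS]; linarith) (by rw [hT]; linarith) hPS hQT
  rw [hS, hT, hP, hQ, hST, hPQ] at key
  generalize coshDist x x' = a at *
  generalize coshDist y y' = b at *
  generalize coshDist x y = c at *
  generalize coshDist x y' + coshDist x' y = e at *
  by_contra! hcon
  -- Since `(a - 1) / (a + 1)` increases with `a`, both ratios are at most `(M - 1) / (M + 1)`.
  -- Taking roots gives `(e - 2c)(M + 1) ≤ (M - 1)(e + 2c)`, which is `e ≤ 2 M c`.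
  have h1 : (a - 1) * (M + 1) ≤ (M - 1) * (a + 1) := by nlinarith
  have h2 : (b - 1) * (M + 1) ≤ (M - 1) * (b + 1) := by nlinarith
  have h3 : (a - 1) * (M + 1) * ((b - 1) * (M + 1)) ≤ (M - 1) * (a + 1) * ((M - 1) * (b + 1)) :=
    mul_le_mul h1 h2 (mul_nonneg (by linarith) (by linarith))
      (mul_nonneg (by linarith) (by linarith))
  have h4 : (2 * c - e) ^ 2 * (M + 1) ^ 2 * ((a + 1) * (b + 1)) ≤
      (M - 1) ^ 2 * (2 * c + e) ^ 2 * ((a + 1) * (b + 1)) := by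
    have := mul_le_mul_of_nonneg_right h3 (sq_nonneg (2 * c + e))
    have h5 := mul_le_mul_of_nonneg_right key (sq_nonneg (M + 1))
    linarith
  have h5 := le_of_mul_le_mul_right h4 (mul_pos (by linarith) (by linarith))
  have h6 : ((e - 2 * c) * (M + 1)) ^ 2 ≤ ((M - 1) * (2 * c + e)) ^ 2 := by linarith
  have hM : 1 ≤ M := by linarith
  have hc0 : 0 ≤ 2 * M * c := by positivity
  have h7 := abs_le_of_sq_le_sq h6 (mul_nonneg (by linarith) (by linarith))
  have h8 := (le_abs_self _).trans h7
  nlinarith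

/-- The set of points moved by less than `ε` by an isometry is convex. -/
theorem geodConvex_displacement_lt (g : HypSpace n ≃ᵢ HypSpace n) (ε : ℝ) :
    GeodConvex {x | dist x (g x) < ε} := by
  intro x hx y hy z hz
  have hε : 0 < ε := dist_nonneg.trans_lt hx
  obtain ⟨a, b, ha, hb, hc⟩ := exists_coeff (mem_segment_of_dist hz)
  have hg := coeff_map g ha hb hc
  have hn := coeff_norm hc
  simp only [Set.mem_ofPred_eq] at *
  rw [dist_lt_iff hε.le] at *
  set M := max (coshDist x (g x)) (coshDist y (g y)) with hM
  have hlt : M < Real.cosh ε := max_lt hx hy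
  refine lt_of_le_of_lt ?_ hlt
  have h1 : coshDist x (g x) ≤ M := le_max_left _ _
  have h2 : coshDist y (g y) ≤ M := le_max_right _ _
  have h3 := coshDist_diagonals (coshDist_map g x y) h1 h2
  rw [hc, coshDist_comm x, coshDist_comm y, hg x, hg y, coshDist_comm (g x) x,
    coshDist_comm (g y) y, coshDist_comm (g y) x]
  have h4 := mul_le_mul_of_nonneg_left h3 (mul_nonneg ha hb)
  have h5 := mul_le_mul_of_nonneg_left h1 (sq_nonneg a)
  have h6 := mul_le_mul_of_nonneg_left h2 (sq_nonneg b)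
  have h7 : M * (a ^ 2 + b ^ 2 + 2 * a * b * coshDist x y) = M := by rw [hn, mul_one]
  linarith

/-! ### Circumcentres and fixed points -/

/-- The orbit of a point. -/
def orbit (Γ : Subgroup (HypSpace n ≃ᵢ HypSpace n)) (x : HypSpace n) : Set (HypSpace n) :=
  {y | ∃ γ ∈ Γ, y = γ x}

/-- A group with a bounded orbit fixes a point in every invariant closed convex set. -/
theorem exists_fixed_point {Γ : Subgroup (HypSpace n ≃ᵢ HypSpace n)} {x : HypSpace n}
    (h : Bornology.IsBounded (orbit Γ x)) {C : Set (HypSpace n)} (hne : C.Nonempty)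
    (hcl : IsClosed C) (hconv : GeodConvex C) (hinv : Invariant Γ C) :
    ∃ p ∈ C, ∀ γ ∈ Γ, γ p = p := by
  -- The fixed point is the circumcentre of the orbit relative to `C`: the only point of `K R` for
  -- the least `R` with `K R` nonempty.
  let K : ℝ → Set (HypSpace n) := fun R => {z ∈ C | ∀ γ ∈ Γ, coshDist z (γ x) ≤ R}
  have hcont : ∀ y : HypSpace n, Continuous fun z => coshDist z y := fun y => by
    simp_rw [← cosh_dist]; fun_prop
  have hKcl : ∀ R, IsClosed (K R) := fun R => by
    have : K R = C ∩ ⋂ γ ∈ Γ, {z | coshDist z (γ x) ≤ R} := by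
      ext z
      simp [K]
    rw [this]
    exact hcl.inter (isClosed_biInter fun γ _ => isClosed_le (hcont _) continuous_const)
  have hKcomp : ∀ R, IsCompact (K R) := fun R => by
    refine (isCompact_closedBall x (Real.arcosh R)).of_isClosed_subset (hKcl R) ?_
    rintro z ⟨-, hz⟩
    have h1 : coshDist z x ≤ R := hz 1 Γ.one_mem
    have hR : 1 ≤ R := (one_le_coshDist _ _).trans h1
    rw [Metric.mem_closedBall, dist_le_iff (Real.arcosh_nonneg hR), Real.cosh_arcosh hR]
    exact h1
  have hKmono : ∀ {R S}, R ≤ S → K R ⊆ K S := fun hRS z hz =>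
    ⟨hz.1, fun γ hγ => (hz.2 γ hγ).trans hRS⟩
  let T : Set ℝ := {R | (K R).Nonempty}
  have hTne : T.Nonempty := by
    obtain ⟨q, hq⟩ := hne
    obtain ⟨R, hR⟩ := (Metric.isBounded_iff_subset_closedBall q).1 h
    refine ⟨Real.cosh R, q, hq, fun γ hγ => ?_⟩
    have h1 := hR ⟨γ, hγ, rfl⟩
    rw [Metric.mem_closedBall, dist_comm] at h1
    exact (dist_le_iff (dist_nonneg.trans h1)).1 h1
  have hTb : BddBelow T := ⟨1, fun R ⟨z, hz⟩ =>
    (one_le_coshDist _ _).trans (hz.2 1 Γ.one_mem)⟩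
  set R₀ := sInf T with hR₀
  have hKR : (K R₀).Nonempty := by
    have hex : ∀ k : ℕ, (K (R₀ + 1 / (k + 1))).Nonempty := fun k => by
      obtain ⟨R, hR, hlt⟩ := exists_lt_of_csInf_lt hTne
        (show sInf T < R₀ + 1 / ((k : ℝ) + 1) from lt_add_of_pos_right _ (by positivity))
      exact Set.Nonempty.mono (hKmono hlt.le) hR
    obtain ⟨z, hz⟩ := IsCompact.nonempty_iInter_of_sequence_nonempty_isCompact_isClosed
      (fun k : ℕ => K (R₀ + 1 / (k + 1)))
      (fun k => hKmono (by
        gcongr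
        linarith)) hex (hKcomp _) (fun _ => hKcl _)
    rw [Set.mem_iInter] at hz
    refine ⟨z, (hz 0).1, fun γ hγ => ?_⟩
    refine le_of_forall_pos_le_add fun e he => ?_
    obtain ⟨k, hk⟩ := exists_nat_one_div_lt he
    exact ((hz k).2 γ hγ).trans (by linarith)
  have huniq : ∀ y ∈ K R₀, ∀ z ∈ K R₀, y = z := by
    intro y hy z hz
    by_contra hyz
    have hc : 1 < coshDist y z :=
      lt_of_le_of_ne (one_le_coshDist y z) fun h => hyz (eq_of_coshDist y z h.symm)
    -- The midpoint `m` satisfies `r m = y + z` on the hyperboloid with `r > 2`, so it improves the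
    -- radius by the factor `2 / r < 1`.
    obtain ⟨m, r, hr, hm, hmc⟩ := exists_of_coeff y z zero_le_one zero_le_one (by norm_num)
    have h1 := hmc m
    have h2 := hmc y
    have h3 := hmc z
    rw [coshDist_self] at h1 h2 h3
    rw [coshDist_comm m y, coshDist_comm z y] at h2
    rw [coshDist_comm m z] at h3
    have hr2 : 2 < r := by nlinarith
    have hmK : m ∈ K (2 / r * R₀) := by
      refine ⟨hconv y hy.1 z hz.1 m (dist_of_mem_segment hm), fun γ hγ => ?_⟩
      have h4 := hmc (γ x)
      have h5 := hy.2 γ hγ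
      have h6 := hz.2 γ hγ
      rw [div_mul_eq_mul_div, le_div_iff₀ hr]
      linarith
    have h7 : R₀ ≤ 2 / r * R₀ := csInf_le hTb ⟨m, hmK⟩
    have h8 : 1 ≤ R₀ := (one_le_coshDist _ _).trans (hy.2 1 Γ.one_mem)
    have h9 : 2 / r < 1 := by rw [div_lt_one hr]; exact hr2
    nlinarith
  obtain ⟨p, hp⟩ := hKR
  refine ⟨p, hp.1, fun γ hγ => (huniq _ ⟨hinv γ hγ p hp.1, fun δ hδ => ?_⟩ _ hp)⟩
  have := hp.2 (γ⁻¹ * δ) (Γ.mul_mem (Γ.inv_mem hγ) hδ)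
  rw [← coshDist_map γ, ← IsometryEquiv.mul_apply, mul_inv_cancel_left] at this
  exact this

/-! ### Boundary behaviour of isometries; geodesic lines -/

section Boundary

/-- The expansion factor of an isometry at the boundary sphere. -/
theorem exists_wt_map_le (g : HypSpace n ≃ᵢ HypSpace n) :
    ∃ k : ℝ, 0 < k ∧ ∀ u, wt (g u) ≤ k * wt u := by
  set q := g.symm (origin n)
  have hq := wt_pos q
  have hq1 : 0 < 1 - ‖q.pt‖ := sub_pos.2 q.norm_lt
  refine ⟨wt q / (1 - ‖q.pt‖), by positivity, fun u => ?_⟩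
  have h1 : coshDist q u = (wt (g u))⁻¹ := by
    rw [← coshDist_origin, ← coshDist_map g, g.apply_symm_apply]
  have h2 := one_sub_inner q u
  have h3 : 1 - ‖q.pt‖ ≤ 1 - inner ℝ q.pt u.pt := by
    have := real_inner_le_norm q.pt u.pt
    nlinarith [norm_nonneg q.pt, u.norm_lt]
  have hg := wt_pos (g u)
  rw [h1] at h2
  rw [h2] at h3
  rw [div_mul_eq_mul_div, le_div_iff₀ hq1]
  calc wt (g u) * (1 - ‖q.pt‖) ≤ wt (g u) * ((wt (g u))⁻¹ * (wt q * wt u)) := by gcongr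
    _ = _ := by field_simp

/-- Write `1 - ⟪u, v⟫` as `coshDist u v` times the two weights: `g` preserves the first factor and
expands the weights boundedly. Since this quantity tends to 0 when `u` and `v` approach the same
ideal point, `g` extends continuously to it. -/
theorem exists_norm_sub_map_le (g : HypSpace n ≃ᵢ HypSpace n) :
    ∃ K : ℝ, ∀ u v, ‖(g u).pt - (g v).pt‖ ^ 2 ≤ K * (1 - inner ℝ u.pt v.pt) := by
  obtain ⟨k, hk, h⟩ := exists_wt_map_le g
  refine ⟨2 * k ^ 2, fun u v => ?_⟩
  have h1 : ‖(g u).pt - (g v).pt‖ ^ 2 ≤ 2 * (1 - inner ℝ (g u).pt (g v).pt) := by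
    rw [norm_sub_sq_real]
    linarith [one_sub_pos (g u), one_sub_pos (g v)]
  rw [one_sub_inner, coshDist_map] at h1
  rw [one_sub_inner]
  have h2 := mul_le_mul (h u) (h v) (wt_pos _).le (mul_nonneg hk.le (wt_pos u).le)
  have h3 := mul_le_mul_of_nonneg_left h2 (zero_le_one.trans (one_le_coshDist u v))
  linarith

theorem mem_limitSet {Γ : Subgroup (HypSpace n ≃ᵢ HypSpace n)} {ξ : EuclideanSpace ℝ (Fin n)}
    (h1 : ‖ξ‖ = 1) {x : HypSpace n} (h : ξ ∈ closure (HypSpace.pt '' orbit Γ x)) :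
    ξ ∈ limitSet Γ := by
  refine ⟨h1, x, closure_mono ?_ h⟩
  rintro _ ⟨_, ⟨γ, hγ, rfl⟩, rfl⟩
  exact ⟨γ, hγ, rfl⟩

theorem exists_seq_of_mem_limitSet {Γ : Subgroup (HypSpace n ≃ᵢ HypSpace n)}
    {ξ : EuclideanSpace ℝ (Fin n)} (h : ξ ∈ limitSet Γ) :
    ∃ (x : HypSpace n) (y : ℕ → HypSpace n), (∀ k, y k ∈ orbit Γ x) ∧
      Tendsto (fun k => (y k).pt) atTop (𝓝 ξ) := by
  obtain ⟨-, x, hx⟩ := h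
  obtain ⟨u, hu, hlim⟩ := mem_closure_iff_seq_limit.1 hx
  choose γ hγ hγu using hu
  refine ⟨x, fun k => γ k x, fun k => ⟨γ k, hγ k, rfl⟩, ?_⟩
  convert hlim using 2 with k
  exact (hγu k).symm

/-- Elements of `Γ` extend continuously to the limit set, which they preserve. -/
theorem exists_limitSet_map {Γ : Subgroup (HypSpace n ≃ᵢ HypSpace n)}
    {ξ : EuclideanSpace ℝ (Fin n)} (h : ξ ∈ limitSet Γ) {γ : HypSpace n ≃ᵢ HypSpace n}
    (hγ : γ ∈ Γ) :
    ∃ ξ' ∈ limitSet Γ, ∀ {X : Type} {l : Filter X} {f : X → HypSpace n},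
      Tendsto (fun t => (f t).pt) l (𝓝 ξ) → Tendsto (fun t => (γ (f t)).pt) l (𝓝 ξ') := by
  obtain ⟨x, y, hy, hlim⟩ := exists_seq_of_mem_limitSet h
  obtain ⟨ξ', -, φ, hφ, hlim'⟩ := (isCompact_closedBall (0 : EuclideanSpace ℝ (Fin n)) 1).tendsto_subseq
    (x := fun k => (γ (y k)).pt) fun k => by simpa using (γ (y k)).norm_lt.le
  have hsub : Tendsto (fun k => (y (φ k)).pt) atTop (𝓝 ξ) := hlim.comp hφ.tendsto_atTop
  have hξ' : ‖ξ'‖ = 1 := by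
    obtain ⟨k, hk, hk'⟩ := exists_wt_map_le γ
    have h1 : Tendsto (fun j => 1 - ‖(y (φ j)).pt‖ ^ 2) atTop (𝓝 0) := by
      simpa [h.1] using (hsub.norm.pow 2).const_sub 1
    have h2 : Tendsto (fun j => 1 - ‖(γ (y (φ j))).pt‖ ^ 2) atTop (𝓝 0) := by
      refine squeeze_zero (fun j => (one_sub_pos _).le) (fun j => ?_)
        (by simpa using h1.const_mul (k ^ 2))
      rw [← wt_sq, ← wt_sq, ← mul_pow]
      exact pow_le_pow_left₀ (wt_pos _).le (hk' _) 2
    have h3 : Tendsto (fun j => 1 - ‖(γ (y (φ j))).pt‖ ^ 2) atTop (𝓝 (1 - ‖ξ'‖ ^ 2)) :=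
      tendsto_const_nhds.sub (hlim'.norm.pow 2)
    have := tendsto_nhds_unique h2 h3
    nlinarith [norm_nonneg ξ']
  refine ⟨ξ', mem_limitSet (x := x) hξ' ?_, fun {X l f} hf => ?_⟩
  · refine mem_closure_of_tendsto hlim' (Eventually.of_forall fun k => ⟨_, ?_, rfl⟩)
    obtain ⟨δ, hδ, e⟩ := hy (φ k)
    exact ⟨γ * δ, Γ.mul_mem hγ hδ, by rw [IsometryEquiv.mul_apply, e]⟩
  · obtain ⟨K, hK⟩ := exists_norm_sub_map_le γ
    have h1 : ∀ u : HypSpace n, ‖(γ u).pt - ξ'‖ ^ 2 ≤ K * (1 - inner ℝ u.pt ξ) := fun u =>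
      le_of_tendsto_of_tendsto' ((tendsto_const_nhds.sub hlim').norm.pow 2)
        ((tendsto_const_nhds.sub (tendsto_const_nhds.inner hsub)).const_mul K)
        fun k => hK u (y (φ k))
    have h2 : Tendsto (fun t => √(K * (1 - inner ℝ (f t).pt ξ))) l (𝓝 0) := by
      have := ((hf.inner (tendsto_const_nhds (x := ξ))).const_sub 1 |>.const_mul K).sqrt
      simpa [real_inner_self_eq_norm_sq, h.1] using this
    rw [tendsto_iff_norm_sub_tendsto_zero]
    exact squeeze_zero (fun _ => norm_nonneg _) (fun t => Real.le_sqrt_of_sq_le (h1 _)) h2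

theorem exists_geodesicLine {ξ η : EuclideanSpace ℝ (Fin n)} (hξ : ‖ξ‖ = 1) (hη : ‖η‖ = 1)
    (hne : ξ ≠ η) : ∃ c : ℝ → HypSpace n, IsGeodesicLine c ξ η := by
  have hk : 0 < 1 - (inner ℝ ξ η : ℝ) := by
    have := (inner_lt_one_iff_real_of_norm_eq_one hξ hη).2 hne
    linarith
  obtain ⟨k, ek⟩ : ∃ k, k = 1 - (inner ℝ ξ η : ℝ) := ⟨_, rfl⟩
  have hin : (inner ℝ ξ η : ℝ) = 1 - k := by linarith
  rw [← ek] at hk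
  let h : ℝ → ℝ := fun t => Real.exp t + Real.exp (-t)
  have hh : ∀ t, 0 < h t := fun t => by positivity
  -- On the light cone the line is `e^{-t} ξ + e^t η` up to a constant; dividing by `h t` makes it
  -- an affine combination.
  let p : ℝ → EuclideanSpace ℝ (Fin n) := fun t =>
    (Real.exp (-t) / h t) • ξ + (Real.exp t / h t) • η
  have hpp : ∀ s t, h s * h t * (1 - inner ℝ (p s) (p t)) =
      k * (Real.exp (t - s) + Real.exp (s - t)) := fun s t => by
    have := hh s
    have := hh t
    simp only [p, inner_add_left, inner_add_right, inner_smul_left, inner_smul_right,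
      RCLike.conj_to_real, real_inner_self_eq_norm_sq, hξ, hη, real_inner_comm ξ η, hin]
    rw [sub_eq_add_neg t, sub_eq_add_neg s, Real.exp_add, Real.exp_add]
    field_simp
    simp only [h]
    ring
  have hnorm : ∀ t, h t ^ 2 * (1 - ‖p t‖ ^ 2) = 2 * k := fun t => by
    have := hpp t t
    rw [real_inner_self_eq_norm_sq, sub_self, Real.exp_zero] at this
    linarith
  have hlt : ∀ t, ‖p t‖ < 1 := fun t => by
    have h1 : 0 < 1 - ‖p t‖ ^ 2 := by
      by_contra! hcon
      have := mul_nonpos_of_nonneg_of_nonpos (sq_nonneg (h t)) hcon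
      linarith [hnorm t]
    nlinarith [norm_nonneg (p t)]
  let c : ℝ → HypSpace n := fun t => ⟨p t, hlt t⟩
  have hwt : ∀ t, h t * wt (c t) = √(2 * k) := fun t => by
    rw [← hnorm t, Real.sqrt_mul (sq_nonneg _), Real.sqrt_sq (hh t).le]
    rfl
  have hsig : Tendsto (fun t : ℝ => Real.exp (-t) / h t) atTop (𝓝 0) := by
    refine squeeze_zero (fun t => (div_pos (Real.exp_pos _) (hh t)).le) (fun t => ?_)
      (Real.tendsto_exp_neg_atTop_nhds_zero)
    rw [div_le_iff₀ (hh t)]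
    have h1 : Real.exp (-t) * Real.exp t = 1 := by rw [← Real.exp_add]; simp
    have h2 : 0 < Real.exp (-t) * Real.exp (-t) := by positivity
    have h3 : Real.exp (-t) * h t = 1 + Real.exp (-t) * Real.exp (-t) := by
      simp only [h]; rw [mul_add, h1]
    have h5 : (2 * Real.exp (-t)) ≤ 1 + Real.exp (-t) * Real.exp (-t) := by
      nlinarith [sq_nonneg (Real.exp (-t) - 1)]
    linarith [Real.exp_pos (-t)]
  have hsum : ∀ t, Real.exp t / h t = 1 - Real.exp (-t) / h t := fun t => by
    have := (hh t).ne'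
    field_simp
    simp [h]
  have hsym : ∀ t, h (-t) = h t := fun t => by simp only [h, neg_neg]; ring
  refine ⟨c, ?_, ?_, ?_⟩
  · refine Isometry.of_dist_eq fun s t => ?_
    have h1 : coshDist (c s) (c t) = Real.cosh (s - t) := by
      have e1 := one_sub_inner (c s) (c t)
      have e2 := hpp s t
      have e3 : h s * h t * (wt (c s) * wt (c t)) = 2 * k := by
        rw [← Real.mul_self_sqrt (show 0 ≤ 2 * k by linarith)]
        nth_rw 1 [← hwt s]
        rw [← hwt t]
        ring
      rw [show (c s).pt = p s from rfl, show (c t).pt = p t from rfl] at e1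
      rw [e1] at e2
      have e4 : 2 * k * coshDist (c s) (c t) = 2 * k * Real.cosh (s - t) := by
        rw [Real.cosh_eq, neg_sub]
        linear_combination e2 - coshDist (c s) (c t) * e3
      exact mul_left_cancel₀ (by linarith) e4
    apply Real.cosh_injOn (Set.mem_Ici.2 dist_nonneg) (Set.mem_Ici.2 dist_nonneg)
    rw [cosh_dist, h1, Real.dist_eq, Real.cosh_abs]
  · have hsig' : Tendsto (fun t : ℝ => Real.exp t / h t) atBot (𝓝 0) := by
      have := hsig.comp tendsto_neg_atBot_atTop
      refine this.congr fun t => ?_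
      simp only [Function.comp, neg_neg, hsym]
    have h1 : Tendsto (fun t : ℝ => Real.exp (-t) / h t) atBot (𝓝 1) := by
      have := hsig'.const_sub 1
      rw [sub_zero] at this
      refine this.congr fun t => ?_
      rw [hsum]; ring
    simpa using (h1.smul_const ξ).add (hsig'.smul_const η)
  · have h1 : Tendsto (fun t : ℝ => Real.exp t / h t) atTop (𝓝 1) := by
      have := hsig.const_sub 1
      rw [sub_zero] at this
      exact this.congr fun t => (hsum t).symm
    simpa using (hsig.smul_const ξ).add (h1.smul_const η)

end Boundary

/-! ### The hull of the limit set and invariance -/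

section Hull

variable {Γ : Subgroup (HypSpace n ≃ᵢ HypSpace n)}

theorem geodConvex_hull : GeodConvex (hull Γ) := GeodConvex.sInter fun _ hA => hA.1

theorem range_subset_hull {ξ η : EuclideanSpace ℝ (Fin n)} (hξ : ξ ∈ limitSet Γ)
    (hη : η ∈ limitSet Γ) {c : ℝ → HypSpace n} (hc : IsGeodesicLine c ξ η) :
    Set.range c ⊆ hull Γ := fun _ hx _ hC => hC.2 ξ hξ η hη c hc hx

theorem invariant_hull : Invariant Γ (hull Γ) := by
  intro γ hγ x hx C hC
  refine hx (γ ⁻¹' C) ⟨hC.1.preimage γ, fun ξ hξ η hη c hc => ?_⟩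
  obtain ⟨ξ', hξ', h1⟩ := exists_limitSet_map hξ hγ
  obtain ⟨η', hη', h2⟩ := exists_limitSet_map hη hγ
  have := hC.2 ξ' hξ' η' hη' (fun t => γ (c t)) ⟨γ.isometry.comp hc.1, h1 hc.2.1, h2 hc.2.2⟩
  rintro _ ⟨t, rfl⟩
  exact this ⟨t, rfl⟩

theorem limitSet_subset_closure_hull (h : (limitSet Γ).Nontrivial) :
    limitSet Γ ⊆ closure (HypSpace.pt '' hull Γ) := by
  intro ξ hξ
  obtain ⟨η, hη, hne⟩ := h.exists_ne ξ
  obtain ⟨c, hc⟩ := exists_geodesicLine hξ.1 hη.1 hne.symm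
  exact mem_closure_of_tendsto hc.2.1
    (Eventually.of_forall fun t => ⟨c t, range_subset_hull hξ hη hc ⟨t, rfl⟩, rfl⟩)

theorem hull_nonempty (h : (limitSet Γ).Nontrivial) : (hull Γ).Nonempty := by
  obtain ⟨ξ, hξ⟩ := h.nonempty
  have := limitSet_subset_closure_hull h hξ
  exact (closure_nonempty_iff.1 ⟨ξ, this⟩).of_image

theorem Invariant.closure {A : Set (HypSpace n)} (h : Invariant Γ A) :
    Invariant Γ (closure A) := fun γ hγ _ hx =>
  map_mem_closure γ.continuous hx fun y hy => h γ hγ y hy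

theorem invariant_thin (ε : ℝ) : Invariant Γ (thin ε Γ) := by
  rintro γ hγ x ⟨δ, hδ, hne, hd⟩
  refine ⟨γ * δ * γ⁻¹, Γ.mul_mem (Γ.mul_mem hγ hδ) (Γ.inv_mem hγ), ?_, ?_⟩
  · rw [Ne, mul_inv_eq_one]
    simpa using hne
  · rw [← IsometryEquiv.mul_apply, inv_mul_cancel_right, IsometryEquiv.mul_apply, γ.dist_eq]
    exact hd

end Hull

/-! ### Quasiconvexity and convex hulls -/

section QuasiConvex

/-- If every point of `Y` is joined inside `closure Y` to a convex set `H` of points and ideal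
points lying in `closure Y`, then `Y` is quasiconvex. -/
theorem quasiconvex_of_hub {Y : Set (HypSpace n)} {H : Set (EuclideanSpace ℝ (Fin n))}
    (hH : Convex ℝ H) (hH1 : ∀ a ∈ H, ‖a‖ ≤ 1) (hHY : ∀ z : HypSpace n, z.pt ∈ H → z ∈ closure Y)
    (hY : ∀ x ∈ Y, ∃ a ∈ H, ∀ z : HypSpace n, z.pt ∈ segment ℝ x.pt a → z ∈ closure Y)
    {x y z : HypSpace n} (hx : x ∈ Y) (hy : y ∈ Y) (hz : z.pt ∈ segment ℝ x.pt y.pt) :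
    ∃ w ∈ Y, dist z w ≤ 2 * thinness + 1 := by
  suffices h : ∃ w ∈ closure Y, dist z w ≤ 2 * thinness by
    obtain ⟨w, hw, hd⟩ := h
    obtain ⟨v, hv, hd'⟩ := Metric.mem_closure_iff.1 hw 1 one_pos
    exact ⟨v, hv, (dist_triangle z w v).trans (by linarith)⟩
  have hδ := thinness_pos
  obtain ⟨a, ha, hxa⟩ := hY x hx
  obtain ⟨b, hb, hyb⟩ := hY y hy
  -- The two triangles are `x y a` and `y a b`; their sides other than `[x, y]` and the shared `[y,
  -- a]` lie in `closure Y` wherever they are finite.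
  obtain ⟨w, hw, hd⟩ := thin_triangle x.norm_lt.le y.norm_lt.le (hH1 a ha) hz
  rcases hw with hw | hw
  · exact ⟨w, hxa w hw, by linarith⟩
  obtain ⟨v, hv, hd'⟩ := thin_triangle y.norm_lt.le (hH1 a ha) (hH1 b hb) hw
  refine ⟨v, ?_, (dist_triangle z w v).trans (by linarith)⟩
  rcases hv with hv | hv
  · exact hyb v hv
  · exact hHY v (hH.segment_subset ha hb hv)

/-- Induction on the number of vertices. A point of the simplex lies on a segment from a vertex `x`
to a point `u` of the opposite face, and `u` is near some `w ∈ Y`. In the triangle `x u w` the point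
is near `[x, w]`, which is close to `Y`, or near `[u, w]`, which is no longer than the inductive
bound. -/
theorem dist_convexHull_le {Y : Set (HypSpace n)} {c : ℝ} (hc : 0 ≤ c)
    (hY : ∀ x ∈ Y, ∀ y ∈ Y, ∀ z : HypSpace n, z.pt ∈ segment ℝ x.pt y.pt →
      ∃ w ∈ Y, dist z w ≤ c) (k : ℕ) :
    ∀ t : Finset (EuclideanSpace ℝ (Fin n)), (t : Set _) ⊆ HypSpace.pt '' Y → t.card ≤ k + 1 →
      ∀ z : HypSpace n, z.pt ∈ convexHull ℝ (t : Set (EuclideanSpace ℝ (Fin n))) →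
        ∃ w ∈ Y, dist z w ≤ k * (thinness + c) := by
  classical
  have hδ := thinness_pos
  induction k with
  | zero =>
    intro t ht hcard z hz
    have hne : t.Nonempty := by
      rw [← Finset.coe_nonempty, ← convexHull_nonempty_iff (𝕜 := ℝ)]
      exact ⟨_, hz⟩
    obtain ⟨u, rfl⟩ := Finset.card_eq_one.1 (le_antisymm hcard hne.card_pos)
    rw [Finset.coe_singleton, convexHull_singleton, Set.mem_singleton_iff] at hz
    obtain ⟨w, hw, e⟩ := ht (Finset.mem_coe.2 (Finset.mem_singleton_self u))
    have : z = w := HypSpace.ext (hz.trans e.symm)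
    exact ⟨w, hw, by simp [this]⟩
  | succ k ih =>
    intro t ht hcard z hz
    rcases hcard.lt_or_eq with h | h
    · obtain ⟨w, hw, hd⟩ := ih t ht (by omega) z hz
      refine ⟨w, hw, hd.trans ?_⟩
      push_cast
      nlinarith
    obtain ⟨a, t', hat, rfl, hct⟩ := Finset.card_eq_succ.1 h
    have hne : (t' : Set (EuclideanSpace ℝ (Fin n))).Nonempty := by
      rw [Finset.coe_nonempty, ← Finset.card_pos]; omega
    have ht' : (t' : Set (EuclideanSpace ℝ (Fin n))) ⊆ HypSpace.pt '' Y :=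
      (Finset.coe_subset.2 (Finset.subset_insert a t')).trans ht
    rw [Finset.coe_insert, convexHull_insert hne, convexJoin_singleton_left,
      Set.mem_iUnion₂] at hz
    obtain ⟨u, hu, hz⟩ := hz
    obtain ⟨x, hx, rfl⟩ := ht (Finset.mem_coe.2 (Finset.mem_insert_self a t'))
    have hu1 : ‖u‖ < 1 := by
      have h1 : (t' : Set (EuclideanSpace ℝ (Fin n))) ⊆ Metric.ball 0 1 := fun v hv => by
        obtain ⟨y, -, rfl⟩ := ht' hv
        simpa using y.norm_lt
      simpa using convexHull_min h1 (convex_ball _ _) hu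
    obtain ⟨w, hw, hd⟩ := ih t' ht' (by omega) ⟨u, hu1⟩ hu
    obtain ⟨v, hv, hzv⟩ := thin_triangle x.norm_lt.le hu1.le w.norm_lt.le hz
    have hk : 0 ≤ (k : ℝ) * (thinness + c) := by positivity
    rcases hv with hv | hv
    · obtain ⟨y, hy, hvy⟩ := hY x hx w hw v hv
      refine ⟨y, hy, (dist_triangle z v y).trans ?_⟩
      push_cast
      linarith
    · have h1 := dist_of_mem_segment (x := ⟨u, hu1⟩) hv
      have h2 := dist_nonneg (x := (⟨u, hu1⟩ : HypSpace n)) (y := v)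
      refine ⟨w, hw, (dist_triangle z v w).trans ?_⟩
      push_cast
      linarith

/-- The constant of the theorem. -/
noncomputable def hullConstant (n : ℕ) : ℝ := n * (thinness + (2 * thinness + 1)) + 1

theorem hullConstant_pos (n : ℕ) : 0 < hullConstant n := by
  have := thinness_pos
  unfold hullConstant
  positivity

theorem closedHull_subset_thickening {Y : Set (HypSpace n)}
    (hY : ∀ x ∈ Y, ∀ y ∈ Y, ∀ z : HypSpace n, z.pt ∈ segment ℝ x.pt y.pt →
      ∃ w ∈ Y, dist z w ≤ 2 * thinness + 1) {z : HypSpace n}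
    (hz : z.pt ∈ closure (convexHull ℝ (HypSpace.pt '' Y))) :
    z ∈ Metric.thickening (hullConstant n) Y := by
  have hδ := thinness_pos
  have hS : HypSpace.pt '' {z : HypSpace n | z.pt ∈ convexHull ℝ (HypSpace.pt '' Y)} =
      convexHull ℝ (HypSpace.pt '' Y) := by
    apply Set.Subset.antisymm
    · rintro _ ⟨z, hz, rfl⟩
      exact hz
    · intro u hu
      have h1 : HypSpace.pt '' Y ⊆ Metric.ball 0 1 := by
        rintro _ ⟨y, -, rfl⟩
        simpa using y.norm_lt
      have hu1 : ‖u‖ < 1 := by simpa using convexHull_min h1 (convex_ball _ _) hu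
      exact ⟨⟨u, hu1⟩, hu, rfl⟩
  rw [← hS] at hz
  -- Passing from the closed hull to the hull costs the summand 1 in `hullConstant`.
  obtain ⟨z', hz', hd⟩ := Metric.mem_closure_iff.1 (mem_closure_of_pt hz) 1 one_pos
  rw [Set.mem_ofPred_eq, convexHull_eq_union] at hz'
  simp only [Set.mem_iUnion] at hz'
  obtain ⟨t, ht, hind, hz'⟩ := hz'
  have hcard : t.card ≤ n + 1 := by
    have h1 := hind.card_le_finrank_succ
    have h2 := Submodule.finrank_le (vectorSpan ℝ (Set.range ((↑) : t → EuclideanSpace ℝ (Fin n))))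
    rw [finrank_euclideanSpace_fin] at h2
    rw [Fintype.card_coe] at h1
    omega
  obtain ⟨w, hw, hd'⟩ := dist_convexHull_le (by positivity) hY n t ht hcard z' hz'
  rw [Metric.mem_thickening_iff]
  refine ⟨w, hw, (dist_triangle z z' w).trans_lt ?_⟩
  rw [hullConstant]
  linarith

theorem thickenedHull_subset_of_hub {Γ : Subgroup (HypSpace n ≃ᵢ HypSpace n)} {ε : ℝ}
    {Y : Set (HypSpace n)} (hne : Y.Nonempty) (hinv : Invariant Γ Y) (hthin : thin ε Γ ⊆ Y)
    {H : Set (EuclideanSpace ℝ (Fin n))}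
    (hH : Convex ℝ H) (hH1 : ∀ a ∈ H, ‖a‖ ≤ 1) (hHY : ∀ z : HypSpace n, z.pt ∈ H → z ∈ closure Y)
    (hY : ∀ x ∈ Y, ∃ a ∈ H, ∀ z : HypSpace n, z.pt ∈ segment ℝ x.pt a → z ∈ closure Y) :
    thickenedHull ε Γ ⊆ Metric.thickening (hullConstant n) Y := by
  intro z hz
  -- The closed convex hull of `Y` is one of the sets whose intersection defines the thickened hull.
  have hmem : z ∈ ⋂₀ {C : Set (HypSpace n) | IsClosed C ∧ GeodConvex C ∧ Y ⊆ C} := by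
    refine hz _ ⟨?_, isClosed_sInter fun C hC => hC.1, GeodConvex.sInter fun C hC => hC.2.1, ?_,
      fun x hx C hC => hC.2.2 (hthin hx)⟩
    · obtain ⟨y, hy⟩ := hne
      exact ⟨y, fun C hC => hC.2.2 hy⟩
    · intro γ hγ x hx C hC
      exact hx (γ ⁻¹' C) ⟨hC.1.preimage γ.continuous, hC.2.1.preimage γ,
        fun y hy => hC.2.2 (hinv γ hγ y hy)⟩
  refine closedHull_subset_thickening
    (fun x hx y hy z hz => quasiconvex_of_hub hH hH1 hHY hY hx hy hz) ?_
  exact Set.mem_sInter.1 hmem {z | z.pt ∈ closure (convexHull ℝ (HypSpace.pt '' Y))}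
    ⟨isClosed_closure.preimage continuous_pt, geodConvex_preimage_pt (convex_convexHull ℝ _).closure,
      fun _ hy => subset_closure (subset_convexHull ℝ _ (Set.mem_image_of_mem _ hy))⟩

end QuasiConvex

/-! ### Hubs when the limit set is empty or nontrivial -/

section Hubs

variable {Γ : Subgroup (HypSpace n ≃ᵢ HypSpace n)} {ε : ℝ}

/-- The displacement set of `γ` is convex, hence so is its Euclidean closure, which may contain the
ideal point `a`. -/
theorem mem_closure_thin_of_segment {γ : HypSpace n ≃ᵢ HypSpace n} (hγ : γ ∈ Γ) (hγ1 : γ ≠ 1)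
    {x z : HypSpace n} (hx : dist x (γ x) < ε) {a : EuclideanSpace ℝ (Fin n)}
    (ha : a ∈ closure (HypSpace.pt '' {x | dist x (γ x) < ε})) (hz : z.pt ∈ segment ℝ x.pt a) :
    z ∈ closure (thin ε Γ) := by
  have h1 := (geodConvex_iff.1 (geodConvex_displacement_lt γ ε)).closure.segment_subset
    (subset_closure ⟨x, hx, rfl⟩) ha hz
  have h2 : {x | dist x (γ x) < ε} ⊆ thin ε Γ := fun y hy => ⟨γ, hγ, hγ1, hy⟩
  exact closure_mono h2 (mem_closure_of_pt h1)

/-- A point moved little by `γ` is joined to a limit point, unless `γ` has bounded orbits. -/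
theorem exists_limit_or_isBounded {γ : HypSpace n ≃ᵢ HypSpace n} (hγ : γ ∈ Γ) {x : HypSpace n}
    (hx : dist x (γ x) < ε) :
    (∃ ξ ∈ limitSet Γ, ξ ∈ closure (HypSpace.pt '' {x | dist x (γ x) < ε})) ∨
      Bornology.IsBounded (orbit (Subgroup.zpowers γ) x) := by
  by_cases hb : Bornology.IsBounded (orbit (Subgroup.zpowers γ) x)
  · exact Or.inr hb
  obtain ⟨ξ, hξ, h1⟩ := exists_boundary_of_not_isBounded hb
  refine Or.inl ⟨ξ, mem_limitSet (x := x) h1 (closure_mono (Set.image_mono ?_) hξ),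
    closure_mono (Set.image_mono ?_) hξ⟩
  · rintro _ ⟨g, hg, rfl⟩
    exact ⟨g, (Subgroup.zpowers_le.2 hγ) hg, rfl⟩
  -- Powers of `γ` commute with `γ`, so they preserve its displacement function.
  · rintro _ ⟨g, hg, rfl⟩
    obtain ⟨k, rfl⟩ := hg
    change dist ((γ ^ k) x) (γ ((γ ^ k) x)) < ε
    rw [← IsometryEquiv.mul_apply, (Commute.refl γ).zpow_right k |>.eq, IsometryEquiv.mul_apply,
      IsometryEquiv.dist_eq]
    exact hx

theorem isBounded_orbit_of_limitSet_eq_empty (h : limitSet Γ = ∅) (x : HypSpace n) :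
    Bornology.IsBounded (orbit Γ x) := by
  by_contra hb
  obtain ⟨ξ, hξ, h1⟩ := exists_boundary_of_not_isBounded hb
  have := mem_limitSet h1 hξ
  simp [h] at this

theorem geodConvex_univ : GeodConvex (Set.univ : Set (HypSpace n)) :=
  fun _ _ _ _ _ _ => Set.mem_univ _

theorem exists_fixed_of_limitSet_eq_empty (h : limitSet Γ = ∅) :
    ∃ p : HypSpace n, ∀ γ ∈ Γ, γ p = p := by
  obtain ⟨p, -, hp⟩ := exists_fixed_point (isBounded_orbit_of_limitSet_eq_empty h (origin n))
    ⟨origin n, Set.mem_univ _⟩ isClosed_univ geodConvex_univ fun _ _ _ _ => Set.mem_univ _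
  exact ⟨p, hp⟩

/-- The hub is a global fixed point `p`; it is itself thin as soon as `Γ` has a nontrivial element.
-/
theorem thickenedHull_subset_of_limitSet_eq_empty (hε : 0 < ε) (h : limitSet Γ = ∅)
    (hne : (thin ε Γ).Nonempty) :
    thickenedHull ε Γ ⊆ Metric.thickening (hullConstant n) (thin ε Γ) := by
  obtain ⟨p, hp⟩ := exists_fixed_of_limitSet_eq_empty h
  have hpt : ∀ γ ∈ Γ, dist p (γ p) < ε := fun γ hγ => by rw [hp γ hγ, dist_self]; exact hε
  refine thickenedHull_subset_of_hub hne (invariant_thin ε) subset_rfl (H := {p.pt})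
    (convex_singleton _) ?_ ?_ ?_
  · rintro _ rfl
    exact p.norm_lt.le
  · intro z hz
    obtain ⟨x, γ, hγ, hγ1, -⟩ := hne
    rw [HypSpace.ext (Set.mem_singleton_iff.1 hz)]
    exact subset_closure ⟨γ, hγ, hγ1, hpt γ hγ⟩
  · rintro x ⟨γ, hγ, hγ1, hx⟩
    exact ⟨p.pt, rfl, fun z hz => mem_closure_thin_of_segment hγ hγ1 hx
      (subset_closure ⟨p, hpt γ hγ, rfl⟩) hz⟩

theorem geodConvex_singleton (p : HypSpace n) : GeodConvex {p} := by
  rw [geodConvex_iff, Set.image_singleton]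
  exact convex_singleton _

/-- A global fixed point outside the thin part forces `Γ` to be trivial. Every singleton is then
admissible, and `1 ≤ n` provides two different ones. -/
theorem thickenedHull_eq_empty_of_limitSet_eq_empty (hn : 1 ≤ n) (hε : 0 < ε)
    (h : limitSet Γ = ∅) (hthin : thin ε Γ = ∅) : thickenedHull ε Γ = ∅ := by
  obtain ⟨p, hp⟩ := exists_fixed_of_limitSet_eq_empty h
  have h1 : ∀ γ ∈ Γ, γ = 1 := fun γ hγ => by
    by_contra hne
    have : p ∈ thin ε Γ := ⟨γ, hγ, hne, by rw [hp γ hγ, dist_self]; exact hε⟩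
    simp [hthin] at this
  have h2 : ∀ z ∈ thickenedHull ε Γ, ∀ q, z = q := fun z hz q => by
    refine hz {q} ⟨Set.singleton_nonempty q, isClosed_singleton, geodConvex_singleton q, ?_, ?_⟩
    · rintro γ hγ x rfl
      rw [h1 γ hγ]
      rfl
    · simp [hthin]
  refine Set.eq_empty_of_forall_notMem fun z hz => ?_
  let q : HypSpace n := ⟨EuclideanSpace.single ⟨0, hn⟩ (1 / 2), by simp; norm_num⟩
  have h3 : origin n = q := (h2 z hz _).symm.trans (h2 z hz _)
  have h4 := congrArg (fun x : HypSpace n => ‖x.pt‖) h3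
  simp [origin, q] at h4

theorem thickenedHull_subset_of_nontrivial (hε : 0 < ε) (h : (limitSet Γ).Nontrivial) :
    thickenedHull ε Γ ⊆ Metric.thickening (hullConstant n) (hull Γ ∪ thin ε Γ) := by
  have hhull := hull_nonempty h
  refine thickenedHull_subset_of_hub (hhull.mono Set.subset_union_left) ?_ Set.subset_union_right
    (H := closure (HypSpace.pt '' hull Γ)) (geodConvex_iff.1 geodConvex_hull).closure ?_ ?_ ?_
  · rintro γ hγ x (hx | hx)
    · exact Or.inl (invariant_hull γ hγ x hx)
    · exact Or.inr (invariant_thin ε γ hγ x hx)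
  · intro a ha
    have : closure (HypSpace.pt '' hull Γ) ⊆ Metric.closedBall 0 1 := by
      apply closure_minimal _ Metric.isClosed_closedBall
      rintro _ ⟨x, -, rfl⟩
      simpa using x.norm_lt.le
    simpa using this ha
  · intro z hz
    exact closure_mono Set.subset_union_left (mem_closure_of_pt hz)
  · rintro x (hx | ⟨γ, hγ, hγ1, hx⟩)
    · refine ⟨x.pt, subset_closure ⟨x, hx, rfl⟩, fun z hz => ?_⟩
      rw [segment_same, Set.mem_singleton_iff] at hz
      rw [HypSpace.ext hz]
      exact subset_closure (Or.inl hx)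
    · rcases exists_limit_or_isBounded hγ hx with ⟨ξ, hξ, hξ'⟩ | hb
      · exact ⟨ξ, limitSet_subset_closure_hull h hξ, fun z hz =>
          closure_mono Set.subset_union_right (mem_closure_thin_of_segment hγ hγ1 hx hξ' hz)⟩
      -- For `γ` with a bounded orbit, the fixed point is sought in the invariant set `closure (hull
      -- Γ)`, so that it belongs to the hub.
      · obtain ⟨p, hpC, hp⟩ := exists_fixed_point hb hhull.closure isClosed_closure
          geodConvex_hull.closure (Γ := Subgroup.zpowers γ) fun g hg =>
            invariant_hull.closure g ((Subgroup.zpowers_le.2 hγ) hg)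
        have hpγ : dist p (γ p) < ε := by
          rw [hp γ (Subgroup.mem_zpowers γ), dist_self]; exact hε
        refine ⟨p.pt, ?_, fun z hz => closure_mono Set.subset_union_right
          (mem_closure_thin_of_segment hγ hγ1 hx (subset_closure ⟨p, hpγ, rfl⟩) hz)⟩
        rw [isInducing_pt.closure_eq_preimage_closure_image] at hpC
        exact hpC

end Hubs

/-! ### Busemann functions and a single limit point -/

section Busemann

variable {Γ : Subgroup (HypSpace n ≃ᵢ HypSpace n)} {ε : ℝ} {ξ : EuclideanSpace ℝ (Fin n)}

/-- The exponential of the Busemann function at the ideal point `ξ`. -/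
noncomputable def busemann (ξ : EuclideanSpace ℝ (Fin n)) (x : HypSpace n) : ℝ :=
  (1 - inner ℝ x.pt ξ) / wt x

theorem busemann_pos (hξ : ‖ξ‖ = 1) (x : HypSpace n) : 0 < busemann ξ x :=
  div_pos (one_sub_inner_pos x.norm_lt hξ.le) (wt_pos x)

theorem continuous_busemann : Continuous (busemann (n := n) ξ) :=
  (continuous_const.sub (continuous_pt.inner continuous_const)).div continuous_wt
    fun x => (wt_pos x).ne'

theorem busemann_origin : busemann ξ (origin n) = 1 := by
  rw [busemann, wt_origin]
  simp [origin]

/-- The Busemann function is linear on the hyperboloid. -/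
theorem busemann_coeff (hξ : ‖ξ‖ = 1) {x y z : HypSpace n} {a b : ℝ}
    (h : ∀ w, coshDist z w = a * coshDist x w + b * coshDist y w) :
    busemann ξ z = a * busemann ξ x + b * busemann ξ y := by
  have hx := wt_pos x
  have hy := wt_pos y
  have hz := wt_pos z
  have key : ∀ w : HypSpace n, (1 - inner ℝ z.pt w.pt) / wt z =
      a * ((1 - inner ℝ x.pt w.pt) / wt x) + b * ((1 - inner ℝ y.pt w.pt) / wt y) := fun w => by
    rw [one_sub_inner, one_sub_inner, one_sub_inner, h w]
    field_simp
  -- The relation is affine in the second argument, so its values at `0` and `ξ / 2` extrapolate to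
  -- the ideal point `ξ`.
  let m : HypSpace n := ⟨(1 / 2 : ℝ) • ξ, by rw [norm_smul, hξ]; norm_num⟩
  have h0 := key (origin n)
  have h1 := key m
  simp only [origin, m, inner_zero_right, inner_smul_right] at h0 h1
  have e : ∀ u : HypSpace n, busemann ξ u =
      2 * ((1 - 1 / 2 * inner ℝ u.pt ξ) / wt u) - (1 - 0) / wt u := fun u => by
    rw [busemann]; ring
  rw [e, e, e]
  linear_combination 2 * h1 - h0

theorem geodConvex_horoball (hξ : ‖ξ‖ = 1) {s : ℝ} :
    GeodConvex {x : HypSpace n | busemann ξ x ≤ s} := by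
  intro x hx y hy z hz
  obtain ⟨a, b, ha, hb, h⟩ := exists_coeff (mem_segment_of_dist hz)
  have hn := coeff_norm h
  have hc := one_le_coshDist x y
  simp only [Set.mem_ofPred_eq] at *
  rw [busemann_coeff hξ h]
  have hs : 0 ≤ s := (busemann_pos hξ x).le.trans hx
  have hab : a + b ≤ 1 := by
    nlinarith [mul_nonneg (mul_nonneg ha hb) (sub_nonneg.2 hc)]
  nlinarith [mul_le_mul_of_nonneg_left hx ha, mul_le_mul_of_nonneg_left hy hb]

theorem horoball_nonempty (hξ : ‖ξ‖ = 1) {s : ℝ} (hs : 0 < s) :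
    {x : HypSpace n | busemann ξ x ≤ s}.Nonempty := by
  have hd : 0 < 1 + s ^ 2 := by positivity
  have habs : |(1 - s ^ 2) / (1 + s ^ 2)| < 1 := by
    rw [abs_lt, lt_div_iff₀ hd, div_lt_one hd]
    constructor <;> nlinarith
  let x : HypSpace n := ⟨((1 - s ^ 2) / (1 + s ^ 2)) • ξ, by
    rw [norm_smul, hξ, mul_one]; exact habs⟩
  have hw : wt x = 2 * s / (1 + s ^ 2) := by
    have : (0 : ℝ) ≤ 2 * s / (1 + s ^ 2) := by positivity
    apply (sq_eq_sq₀ (wt_pos x).le this).1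
    rw [wt_sq]
    simp only [x, norm_smul, hξ, mul_one, Real.norm_eq_abs, sq_abs]
    field_simp
    ring
  refine ⟨x, show busemann ξ x ≤ s from le_of_eq ?_⟩
  rw [busemann, hw]
  simp only [x, inner_smul_left, RCLike.conj_to_real, real_inner_self_eq_norm_sq, hξ]
  field_simp
  ring

/-- A group whose limit set is the point `ξ` acts on the Busemann function by scaling. -/
theorem exists_busemann_map (h : limitSet Γ = {ξ}) {γ : HypSpace n ≃ᵢ HypSpace n} (hγ : γ ∈ Γ) :
    ∃ c : ℝ, 0 < c ∧ ∀ x, busemann ξ (γ x) = c * busemann ξ x := by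
  have hξ : ξ ∈ limitSet Γ := by simp [h]
  obtain ⟨-, y, -, hy⟩ := exists_seq_of_mem_limitSet hξ
  obtain ⟨ξ', hξ', hmap⟩ := exists_limitSet_map hξ hγ
  rw [h, Set.mem_singleton_iff] at hξ'
  subst hξ'
  have hγy := hmap hy
  -- The limit of the weight ratios along `y k → ξ'` does not involve `x`, so the Busemann ratio is
  -- the same at every `x`.
  have hratio : ∀ x, Tendsto (fun k => wt (γ (y k)) / wt (y k)) atTop
      (𝓝 (busemann ξ' (γ x) / busemann ξ' x)) := fun x => by
    have h1 : Tendsto (fun k => (1 - inner ℝ (γ x).pt (γ (y k)).pt) / wt (γ x)) atTop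
        (𝓝 (busemann ξ' (γ x))) :=
      ((tendsto_const_nhds.inner hγy).const_sub 1).div_const _
    have h2 : Tendsto (fun k => (1 - inner ℝ x.pt (y k).pt) / wt x) atTop
        (𝓝 (busemann ξ' x)) :=
      ((tendsto_const_nhds.inner hy).const_sub 1).div_const _
    refine (h1.div h2 (busemann_pos hξ.1 x).ne').congr fun k => ?_
    simp only [Pi.div_apply]
    rw [one_sub_inner, one_sub_inner, coshDist_map]
    have := wt_pos x
    have := wt_pos (γ x)
    have := wt_pos (y k)
    have := one_le_coshDist x (y k)
    field_simp
  refine ⟨busemann ξ' (γ (origin n)), busemann_pos hξ.1 _, fun x => ?_⟩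
  have := tendsto_nhds_unique (hratio x) (hratio (origin n))
  rw [busemann_origin, div_one, div_eq_iff (busemann_pos hξ.1 x).ne'] at this
  exact this

/-- Expand `⟪p - ξ, q - ξ⟫` and apply Cauchy–Schwarz with `‖u - ξ‖² ≤ 2 (1 - ⟪u, ξ⟫)`. It will be
used for `γ ^ k o` and its inverse counterpart, where the product of the two terms is exactly `m²`.
-/
theorem one_sub_inner_le {p q : EuclideanSpace ℝ (Fin n)} (hp : ‖p‖ ≤ 1) (hq : ‖q‖ ≤ 1)
    (hξ : ‖ξ‖ = 1) {m : ℝ} (hm : 0 ≤ m)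
    (h : (1 - inner ℝ p ξ) * (1 - inner ℝ q ξ) ≤ m ^ 2) :
    1 - inner ℝ p q ≤ (1 - inner ℝ p ξ) + (1 - inner ℝ q ξ) + 2 * m := by
  have e : ∀ u : EuclideanSpace ℝ (Fin n), ‖u‖ ≤ 1 → ‖u - ξ‖ ^ 2 ≤ 2 * (1 - inner ℝ u ξ) :=
    fun u hu => by
      rw [norm_sub_sq_real, hξ]
      nlinarith [norm_nonneg u]
  have h1 : -(inner ℝ (p - ξ) (q - ξ) : ℝ) ≤ ‖p - ξ‖ * ‖q - ξ‖ :=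
    (neg_le_abs _).trans (abs_real_inner_le_norm _ _)
  have h2 : ‖p - ξ‖ * ‖q - ξ‖ ≤ 2 * m := by
    apply le_of_sq_le_sq _ (by positivity)
    rw [mul_pow]
    have := mul_le_mul (e p hp) (e q hq) (sq_nonneg _)
      (mul_nonneg zero_le_two (one_sub_inner_nonneg hp hξ.le))
    linarith
  simp only [inner_sub_left, inner_sub_right, real_inner_self_eq_norm_sq, hξ,
    real_inner_comm q ξ] at h1
  linarith

/-- With a single limit point no element scales the Busemann function up. -/
theorem busemann_map_le (h : limitSet Γ = {ξ}) {γ : HypSpace n ≃ᵢ HypSpace n} (hγ : γ ∈ Γ)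
    {c : ℝ} (hc : ∀ x, busemann ξ (γ x) = c * busemann ξ x) : c ≤ 1 := by
  by_contra! hc1
  have hξ : ‖ξ‖ = 1 := (show ξ ∈ limitSet Γ by simp [h]).1
  have hpow : ∀ (k : ℕ) x, busemann ξ ((γ ^ k) x) = c ^ k * busemann ξ x := fun k => by
    induction k with
    | zero => intro x; simp
    | succ k ih =>
      intro x
      rw [pow_succ, IsometryEquiv.mul_apply, ih, hc]
      ring
  let o := origin n
  -- If `c > 1`, the growth of `C` along powers of two is at most of order `c ^ k`. As `1 - ⟪γ ^ k
  -- o, ξ⟫ = c ^ k / C k`, these orbit points stay away from `ξ` and produce a second limit point.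
  let C : ℕ → ℝ := fun k => coshDist o ((γ ^ k) o)
  have hwt : ∀ k, wt ((γ ^ k) o) = (C k)⁻¹ := fun k => by
    simp only [C, o]; rw [coshDist_origin, inv_inv]
  have hCinv : ∀ k, coshDist o ((γ ^ k)⁻¹ o) = C k := fun k => by
    rw [← coshDist_map (γ ^ k), IsometryEquiv.apply_inv_self, coshDist_comm]
  have hwt' : ∀ k, wt ((γ ^ k)⁻¹ o) = (C k)⁻¹ := fun k => by
    rw [← hCinv]; simp only [o]; rw [coshDist_origin, inv_inv]
  have hC1 : ∀ k, 1 ≤ C k := fun k => one_le_coshDist _ _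
  have hB : ∀ k, 1 - inner ℝ ((γ ^ k) o).pt ξ = c ^ k / C k := fun k => by
    have h1 := hpow k o
    rw [busemann, hwt, busemann_origin] at h1
    have := hC1 k
    field_simp at h1 ⊢
    linarith
  have hB' : ∀ k, 1 - inner ℝ ((γ ^ k)⁻¹ o).pt ξ = (c ^ k)⁻¹ / C k := fun k => by
    have h1 := hpow k ((γ ^ k)⁻¹ o)
    rw [IsometryEquiv.apply_inv_self, busemann, busemann, hwt'] at h1
    have hb : (1 - inner ℝ o.pt ξ) / wt o = 1 := busemann_origin
    rw [hb] at h1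
    have := hC1 k
    have : 0 < c ^ k := by positivity
    field_simp at h1 ⊢
    linarith
  have hdouble : ∀ k, C (2 * k) ≤ C k * (c ^ k + (c ^ k)⁻¹ + 2) := fun k => by
    have hk := hC1 k
    have hck : 0 < c ^ k := by positivity
    have h1 := one_sub_inner_le ((γ ^ k) o).norm_lt.le ((γ ^ k)⁻¹ o).norm_lt.le hξ
      (m := (C k)⁻¹) (by positivity) (by rw [hB, hB']; apply le_of_eq; field_simp)
    rw [hB, hB', one_sub_inner, hwt, hwt'] at h1
    have h2 : coshDist ((γ ^ k) o) ((γ ^ k)⁻¹ o) = C (2 * k) := by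
      rw [← coshDist_map (γ ^ k), IsometryEquiv.apply_inv_self, coshDist_comm,
        ← IsometryEquiv.mul_apply, ← pow_add, two_mul]
    rw [h2] at h1
    have h3 := mul_le_mul_of_nonneg_right h1 (show 0 ≤ C k ^ 2 by positivity)
    have h4 : C (2 * k) * ((C k)⁻¹ * (C k)⁻¹) * C k ^ 2 = C (2 * k) := by field_simp
    have h5 : (c ^ k / C k + (c ^ k)⁻¹ / C k + 2 * (C k)⁻¹) * C k ^ 2 =
        C k * (c ^ k + (c ^ k)⁻¹ + 2) := by field_simp
    rw [h4, h5] at h3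
    exact h3
  -- `T` makes the bound below an equality at `j = 0`. The induction closes because `L + L⁻¹ + 2 =
  -- (L + 1)² / L` and `(L - 1)(L + 1) = L² - 1`.
  let T : ℝ := C 1 * c / (c - 1) ^ 2
  have hc0 : 0 < c - 1 := by linarith
  have hT : 0 < T := by have := hC1 1; positivity
  have hbound : ∀ j : ℕ, C (2 ^ j) * c ^ 2 ^ j ≤ T * (c ^ 2 ^ j - 1) ^ 2 := fun j => by
    induction j with
    | zero => simp only [T, pow_zero, pow_one]; apply le_of_eq; field_simp
    | succ j ih =>
      have h1 := hdouble (2 ^ j)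
      rw [pow_succ, mul_comm (2 ^ j) 2, pow_mul' c 2]
      obtain ⟨L, eL⟩ : ∃ L, L = c ^ 2 ^ j := ⟨_, rfl⟩
      have hL : 0 < L := by rw [eL]; positivity
      rw [← eL] at h1 ih ⊢
      calc C (2 * 2 ^ j) * L ^ 2 ≤ C (2 ^ j) * (L + L⁻¹ + 2) * L ^ 2 := by gcongr
        _ = (C (2 ^ j) * L) * (L + 1) ^ 2 := by field_simp; ring
        _ ≤ (T * (L - 1) ^ 2) * (L + 1) ^ 2 := by gcongr
        _ = T * (L ^ 2 - 1) ^ 2 := by ring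
  have hfar : ∀ j : ℕ, T⁻¹ ≤ 1 - inner ℝ ((γ ^ 2 ^ j) o).pt ξ := fun j => by
    have hk := hC1 (2 ^ j)
    have hL : 1 ≤ c ^ 2 ^ j := one_le_pow₀ hc1.le
    rw [hB, inv_eq_one_div, div_le_div_iff₀ hT (by linarith)]
    have h1 := hbound j
    have h2 : (c ^ 2 ^ j - 1) ^ 2 ≤ c ^ 2 ^ j * c ^ 2 ^ j := by nlinarith
    have h3 := h1.trans (mul_le_mul_of_nonneg_left h2 hT.le)
    have h4 : C (2 ^ j) * c ^ 2 ^ j ≤ (T * c ^ 2 ^ j) * c ^ 2 ^ j := by linarith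
    have := le_of_mul_le_mul_right h4 (by linarith)
    linarith
  let A : Set (HypSpace n) := Set.range fun j : ℕ => (γ ^ 2 ^ j) o
  have hA : ¬ Bornology.IsBounded A := fun hb => by
    obtain ⟨R, hR⟩ := (Metric.isBounded_iff_subset_closedBall o).1 hb
    obtain ⟨N, hN⟩ := pow_unbounded_of_one_lt (2 * Real.cosh R) hc1
    have h1 : (γ ^ 2 ^ N) o ∈ Metric.closedBall o R := hR ⟨N, rfl⟩
    rw [Metric.mem_closedBall, dist_comm] at h1
    have h2 : C (2 ^ N) ≤ Real.cosh R := (dist_le_iff (dist_nonneg.trans h1)).1 h1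
    have h3 : c ^ N ≤ c ^ 2 ^ N := pow_le_pow_right₀ hc1.le Nat.lt_two_pow_self.le
    have h4 := hB (2 ^ N)
    have h5 : 1 - inner ℝ ((γ ^ 2 ^ N) o).pt ξ ≤ 2 := by
      have := (abs_le.1 (abs_real_inner_le_norm ((γ ^ 2 ^ N) o).pt ξ)).1
      rw [hξ] at this
      linarith [((γ ^ 2 ^ N) o).norm_lt]
    rw [h4, div_le_iff₀ (by linarith [hC1 (2 ^ N)])] at h5
    linarith
  obtain ⟨η, hη, hη1⟩ := exists_boundary_of_not_isBounded hA
  have hηΓ : η ∈ limitSet Γ := by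
    refine mem_limitSet (x := o) hη1 (closure_mono (Set.image_mono ?_) hη)
    rintro _ ⟨j, rfl⟩
    exact ⟨γ ^ 2 ^ j, Γ.pow_mem hγ _, rfl⟩
  rw [h, Set.mem_singleton_iff] at hηΓ
  subst hηΓ
  have hcl : closure (HypSpace.pt '' A) ⊆ {u | T⁻¹ ≤ 1 - inner ℝ u η} := by
    apply closure_minimal
    · rintro _ ⟨_, ⟨j, rfl⟩, rfl⟩
      exact hfar j
    · exact isClosed_le continuous_const
        (continuous_const.sub (continuous_id.inner continuous_const))
  have := hcl hη
  rw [Set.mem_ofPred_eq, real_inner_self_eq_norm_sq, hη1] at this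
  have := inv_pos.2 hT
  linarith

theorem busemann_map (h : limitSet Γ = {ξ}) {γ : HypSpace n ≃ᵢ HypSpace n} (hγ : γ ∈ Γ)
    (x : HypSpace n) : busemann ξ (γ x) = busemann ξ x := by
  obtain ⟨c, hc, hcx⟩ := exists_busemann_map h hγ
  have h1 := busemann_map_le h hγ hcx
  have h2 := busemann_map_le h (Γ.inv_mem hγ) (c := c⁻¹) fun y => by
    have := hcx (γ⁻¹ y)
    rw [IsometryEquiv.apply_inv_self] at this
    rw [this]
    field_simp
  have h3 : 1 ≤ c := by rwa [inv_le_one₀ hc] at h2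
  rw [hcx, le_antisymm h1 h3, one_mul]

/-- All horoballs at `ξ` are invariant, so each is admissible, and no point lies in all of them. -/
theorem thickenedHull_eq_empty_of_limitSet_eq_singleton (h : limitSet Γ = {ξ})
    (hthin : thin ε Γ = ∅) : thickenedHull ε Γ = ∅ := by
  have hξ : ‖ξ‖ = 1 := (show ξ ∈ limitSet Γ by simp [h]).1
  refine Set.eq_empty_of_forall_notMem fun z hz => ?_
  have hz0 := busemann_pos hξ z
  have : busemann ξ z ≤ busemann ξ z / 2 := by
    refine hz {x | busemann ξ x ≤ busemann ξ z / 2} ⟨horoball_nonempty hξ (half_pos hz0),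
      isClosed_le continuous_busemann continuous_const, geodConvex_horoball hξ, ?_, ?_⟩
    · intro γ hγ x hx
      rw [Set.mem_ofPred_eq, busemann_map h hγ]
      exact hx
    · simp [hthin]
  linarith

/-- An element fixing a point and preserving the Busemann function at `ξ` fixes the ray to `ξ`. -/
theorem map_eq_of_mem_openSegment {γ : HypSpace n ≃ᵢ HypSpace n}
    (hB : ∀ x, busemann ξ (γ x) = busemann ξ x) {p z : HypSpace n} (hp : γ p = p)
    (hz : z.pt ∈ openSegment ℝ p.pt ξ) : γ z = z := by
  obtain ⟨s, t, -, -, hst, e⟩ := hz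
  have hz := wt_pos z
  -- The distance from `w` to `z` is determined by the distance from `w` to `p` and the Busemann
  -- value of `w`. Both agree for `z` and `γ z`.
  have key : ∀ w, coshDist w z * wt z = s * (coshDist p w * wt p) + t * busemann ξ w := fun w => by
    have hw := wt_pos w
    have h1 := one_sub_inner w z
    have h2 := one_sub_inner p w
    have h3 : 1 - inner ℝ w.pt ξ = busemann ξ w * wt w := by
      rw [busemann, div_mul_cancel₀ _ hw.ne']
    rw [← e, inner_add_right, inner_smul_right, inner_smul_right, real_inner_comm] at h1
    apply mul_right_cancel₀ hw.ne'
    have : s = 1 - t := by linarith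
    subst this
    linear_combination (-1) * h1 + (1 - t) * h2 + t * h3
  apply eq_of_coshDist
  have h1 := key (γ z)
  have h2 := key z
  rw [hB] at h1
  have h3 : coshDist p (γ z) = coshDist p z := by
    conv_lhs => rw [← hp]
    rw [coshDist_map]
  rw [h3, ← h2, coshDist_self] at h1
  exact mul_right_cancel₀ hz.ne' h1

/-- The hub is `{ξ}`, which has no finite points. If `γ` has a bounded orbit, it fixes a ray ending
at `ξ`, and so `ξ` is in the closure of its displacement set. -/
theorem thickenedHull_subset_of_limitSet_eq_singleton (hε : 0 < ε) (h : limitSet Γ = {ξ})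
    (hne : (thin ε Γ).Nonempty) :
    thickenedHull ε Γ ⊆ Metric.thickening (hullConstant n) (thin ε Γ) := by
  have hξ : ‖ξ‖ = 1 := (show ξ ∈ limitSet Γ by simp [h]).1
  refine thickenedHull_subset_of_hub hne (invariant_thin ε) subset_rfl (H := {ξ})
    (convex_singleton _) ?_ ?_ ?_
  · rintro _ rfl
    exact hξ.le
  · intro z hz
    rw [Set.mem_singleton_iff] at hz
    have := z.norm_lt
    rw [hz, hξ] at this
    exact absurd this (lt_irrefl _)
  · rintro x ⟨γ, hγ, hγ1, hx⟩
    refine ⟨ξ, rfl, fun z hz => mem_closure_thin_of_segment hγ hγ1 hx ?_ hz⟩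
    rcases exists_limit_or_isBounded hγ hx with ⟨η, hη, hη'⟩ | hb
    · rw [h, Set.mem_singleton_iff] at hη
      exact hη ▸ hη'
    · obtain ⟨p, -, hp⟩ := exists_fixed_point hb ⟨x, Set.mem_univ _⟩ isClosed_univ geodConvex_univ
        fun _ _ _ _ => Set.mem_univ _
      refine closure_mono ?_ (segment_subset_closure_openSegment (right_mem_segment ℝ p.pt ξ))
      intro u hu
      have hu1 : ‖u‖ < 1 := by
        obtain ⟨s, t, hs, ht, hst, rfl⟩ := hu
        calc ‖s • p.pt + t • ξ‖ ≤ ‖s • p.pt‖ + ‖t • ξ‖ := norm_add_le _ _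
          _ = s * ‖p.pt‖ + t := by
            rw [norm_smul, norm_smul, hξ, Real.norm_of_nonneg hs.le, Real.norm_of_nonneg ht.le,
              mul_one]
          _ < 1 := by nlinarith [p.norm_lt]
      refine ⟨⟨u, hu1⟩, ?_, rfl⟩
      have := map_eq_of_mem_openSegment (busemann_map h hγ)
        (hp γ (Subgroup.mem_zpowers γ)) (z := ⟨u, hu1⟩) hu
      rw [Set.mem_ofPred_eq, this, dist_self]
      exact hε

end Busemann

end HypSpace

theorem mainTheorem10 (n : ℕ) (hn : 1 ≤ n) :
    ∃ D : ℝ, 0 < D ∧ ∀ ε : ℝ, 0 < ε →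
      ∀ Γ : Subgroup (HypSpace n ≃ᵢ HypSpace n), DiscreteTopology Γ →
        HypSpace.thickenedHull ε Γ ⊆
          Metric.thickening D (HypSpace.hull Γ ∪ HypSpace.thin ε Γ) := by
  refine ⟨HypSpace.hullConstant n, HypSpace.hullConstant_pos n, fun ε hε Γ _ => ?_⟩
  rcases (HypSpace.limitSet Γ).subsingleton_or_nontrivial with hs | hs
  · rcases (HypSpace.thin ε Γ).eq_empty_or_nonempty with ht | ht
    · rcases hs.eq_empty_or_singleton with h | ⟨ξ, h⟩
      · rw [HypSpace.thickenedHull_eq_empty_of_limitSet_eq_empty hn hε h ht]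
        exact Set.empty_subset _
      · rw [HypSpace.thickenedHull_eq_empty_of_limitSet_eq_singleton h ht]
        exact Set.empty_subset _
    · refine Set.Subset.trans ?_ (Metric.thickening_subset_of_subset _ Set.subset_union_right)
      rcases hs.eq_empty_or_singleton with h | ⟨ξ, h⟩
      · exact HypSpace.thickenedHull_subset_of_limitSet_eq_empty hε h ht
      · exact HypSpace.thickenedHull_subset_of_limitSet_eq_singleton hε h ht
  · exact HypSpace.thickenedHull_subset_of_nontrivial hε hs
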